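/- Let $m\ge 1$, let $e_0,\dots,e_m$ generate the real Clifford algebra $\mathbb{R}_{0,m+1}$ ($e_\alpha e_\beta+e_\beta e_\alpha=-2\delta_{\alpha\beta}$), let $\overline{e_0}=-e_0$ and $\sigma_n=2\pi^{n/2}/\Gamma(n/2)$. Write $x=(x_0,\underline{x})\in\mathbb{R}^{m+1}$ as $x=x_0e_0+\underline{x}$, $\underline{x}=\sum_{j=1}^m x_je_j$, $r=|\underline{x}|$, $\underline{\omega}=\underline{x}/r$, $\underline{\partial}=\sum_{j=1}^m e_j\partial_{x_j}$ and $\overline{D}=\tfrac12(\partial_{x_0}-\overline{e_0}\,\underline{\partial})$. Let $$C_{-1}(x)=\frac{1}{\sigma_{m+1}}\frac{x\,\overline{e_0}}{|x|^{m+1}}\quad(x\ne0),\qquad C_{-k-1}=\overline{D}^{\,k}C_{-1}\quad(k\ge 1),$$ and write, uniquely, $C_{-k-1}=\tfrac12A_{-k-1}+\tfrac12\overline{e_0}B_{-k-1}$ with $A_{-k-1},B_{-k-1}$ taking values in the subalgebra generated by $e_1,\dots,e_m$. Let $\delta$ be the Dirac distribution on $\mathbb{R}^m$, $H=-\frac{2}{\sigma_{m+1}}\,\mathrm{Pv}\,\frac{\underline{\omega}}{r^m}$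 the Hilbert kernel, and let $\underline{\partial}^n\delta$, $\underline{\partial}^nH$ be their iterated distributional derivatives. Then, for all $\ell\ge 1$, the distributional limits (in $\mathcal{S}'(\mathbb{R}^m)$, tested against scalar $\varphi\in\mathcal{S}(\mathbb{R}^m)$) $$a_{-k-1}^{\pm}=\lim_{x_0\to0\pm}A_{-k-1}(x_0,\cdot),\qquad b_{-k-1}^{\pm}=\lim_{x_0\to0\pm}B_{-k-1}(x_0,\cdot)$$ exist for $k=2\ell-1$ and $k=2\ell$, and $$a_{-2\ell}^-=a_{-2\ell}^+=-\underline{\partial}^{2\ell-1}H,\qquad a_{-2\ell-1}^-=-a_{-2\ell-1}^+=-\underline{\partial}^{2\ell}\delta,$$ $$b_{-2\ell}^-=-b_{-2\ell}^+=\underline{\partial}^{2\ell-1}\delta,\qquad b_{-2\ell-1}^-=b_{-2\ell-1}^+=\underline{\partial}^{2\ell}H.$$ Moreover, with $\mathrm{Fp}$ the Hadamard finite part (in the radial variable, after taking spherical means of the test function), $$-\underline{\partial}^{2\ell-1}H=(-1)^{\ell-1}2^{\ell-1}(2\ell-1)!!\,\frac{\Gamma(\frac{m+2\ell-1}{2})}{\pi^{\frac{m+1}{2}}}\,\mathrm{Fp}\frac{1}{r^{m+2\ell-1}}=(-1)^{\ell-1}(2\ell-1)!!\,(m+1)(m+3)\cdots(m+2\ell-3)\,\frac{2}{\sigma_{m+1}}\,\mathrm{Fp}\frac{1}{r^{m+2\ell-1}},$$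 $$\underline{\partial}^{2\ell}H=(-1)^{\ell-1}2^{\ell}(2\ell-1)!!\,\frac{\Gamma(\frac{m+2\ell+1}{2})}{\pi^{\frac{m+1}{2}}}\,\mathrm{Fp}\frac{\underline{\omega}}{r^{m+2\ell}}=(-1)^{\ell-1}(2\ell-1)!!\,(m+1)(m+3)\cdots(m+2\ell-1)\,\frac{2}{\sigma_{m+1}}\,\mathrm{Fp}\frac{\underline{\omega}}{r^{m+2\ell}}.$$ -/

import Mathlib

open MeasureTheory Filter Topology Set
open scoped SchwartzMap LineDeriv

noncomputable section

namespace Downstream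

/-! ### The Clifford algebra `ℝ_{0,m+1}` -/

/-- The quadratic form of signature `(0, m+1)` on `ℝ^{m+1}`. -/
def quadForm (m : ℕ) : QuadraticForm ℝ (Fin (m + 1) → ℝ) :=
  QuadraticMap.weightedSumSquares ℝ (fun _ : Fin (m + 1) => (-1 : ℝ))

/-- The universal real Clifford algebra `ℝ_{0,m+1}`. -/
abbrev Cl (m : ℕ) : Type := CliffordAlgebra (quadForm m)

/-- The generators `e_0, e_1, …, e_m`. -/
def e {m : ℕ} (α : Fin (m + 1)) : Cl m :=
  CliffordAlgebra.ι (quadForm m) (Pi.single α 1)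

theorem quadForm_single {m : ℕ} (α : Fin (m + 1)) :
    quadForm m (Pi.single α 1) = -1 := by
  simp [quadForm, QuadraticMap.weightedSumSquares_apply, Pi.single_apply]

theorem e_sq {m : ℕ} (α : Fin (m + 1)) : (e α : Cl m) * e α = -1 := by
  simp [e, CliffordAlgebra.ι_sq_scalar, quadForm_single]

theorem e_anticomm {m : ℕ} {α β : Fin (m + 1)} (h : α ≠ β) :
    (e α : Cl m) * e β = -(e β * e α) := by
  have h1 := CliffordAlgebra.ι_mul_ι_add_swap (Q := quadForm m)
    (Pi.single α (1 : ℝ)) (Pi.single β (1 : ℝ))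
  have h2 : QuadraticMap.polar (quadForm m) (Pi.single α (1 : ℝ)) (Pi.single β (1 : ℝ)) = 0 := by
    simp only [QuadraticMap.polar, quadForm, QuadraticMap.weightedSumSquares_apply,
      ← Finset.sum_sub_distrib]
    refine Finset.sum_eq_zero fun i _ => ?_
    by_cases hi : i = α
    · subst hi; simp [h]
    · simp [Pi.single_apply, hi]
  rw [h2, map_zero] at h1
  exact eq_neg_of_add_eq_zero_left h1

/-- The basis `(e_A)` of `ℝ_{0,m+1}`, indexed by the subsets `A` of `{0, …, m}`. -/
def clBasis (m : ℕ) : Module.Basis (Finset (Fin (m + 1))) ℝ (Cl m) :=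
  letI : Invertible (2 : ℝ) := invertibleOfNonzero two_ne_zero
  ((Pi.basisFun ℝ (Fin (m + 1))).ExteriorAlgebra).map
    (CliffordAlgebra.equivExterior (quadForm m)).symm

instance (m : ℕ) : FiniteDimensional ℝ (Cl m) := Module.Finite.of_basis (clBasis m)

/-- The coordinates of a Clifford number with respect to `(e_A)`. -/
def clCoord (m : ℕ) : Cl m →ₗ[ℝ] EuclideanSpace ℝ (Finset (Fin (m + 1))) :=
  (WithLp.linearEquiv 2 ℝ (Finset (Fin (m + 1)) → ℝ)).symm.toLinearMap ∘ₗ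
    (clBasis m).equivFun.toLinearMap

theorem clCoord_injective (m : ℕ) : Function.Injective (clCoord m) :=
  (WithLp.linearEquiv 2 ℝ (Finset (Fin (m + 1)) → ℝ)).symm.injective.comp
    (clBasis m).equivFun.injective

/-- The Euclidean norm `|c|² = ∑_A c_A²`.  It is used only to speak of limits, derivatives and
integrals in the finite-dimensional space `ℝ_{0,m+1}`. -/
instance (m : ℕ) : NormedAddCommGroup (Cl m) :=
  NormedAddCommGroup.induced _ _ (clCoord m) (clCoord_injective m)

instance (m : ℕ) : NormedSpace ℝ (Cl m) := NormedSpace.induced ℝ _ _ (clCoord m)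

/-! ### Decomposition `ℝ_{0,m+1} = ℝ_{0,m} ⊕ \bar{e_0} ℝ_{0,m}` -/

/-- The subalgebra `ℝ_{0,m}` generated by `e_1, …, e_m`. -/
def subCl (m : ℕ) : Subalgebra ℝ (Cl m) :=
  Algebra.adjoin ℝ (Set.range fun j : Fin m => (e j.succ : Cl m))

/-- The algebra automorphism `c ↦ e_0 ĉ \bar{e_0}` (with `ĉ` the main involution). It maps `e_0`
to `-e_0` and is the identity on `ℝ_{0,m}`. -/
def reflect {m : ℕ} (c : Cl m) : Cl m := e 0 * CliffordAlgebra.involute c * star (e 0)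

/-- The first component of `c`: `c = ½ a + ½ \bar{e_0} b` with `a, b ∈ ℝ_{0,m}`;
see `components_iff`. -/
def compA {m : ℕ} (c : Cl m) : Cl m := c + reflect c

/-- The second component of `c`: `c = ½ a + ½ \bar{e_0} b` with `a, b ∈ ℝ_{0,m}`;
see `components_iff`. -/
def compB {m : ℕ} (c : Cl m) : Cl m := e 0 * (c - reflect c)

theorem star_e {m : ℕ} (α : Fin (m + 1)) : star (e α : Cl m) = -e α := by
  simp [e, CliffordAlgebra.star_ι]

theorem reflect_e_zero_mul {m : ℕ} (c : Cl m) : reflect (e 0 * c) = -(e 0 * reflect c) := by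
  have : CliffordAlgebra.involute (e 0 : Cl m) = -e 0 := by simp [e]
  simp [reflect, this, mul_assoc]

theorem reflect_of_mem {m : ℕ} {c : Cl m} (hc : c ∈ subCl m) : reflect c = c := by
  have key : e 0 * CliffordAlgebra.involute c = c * e 0 := by
    induction hc using Algebra.adjoin_induction with
    | mem x hx =>
      obtain ⟨j, rfl⟩ := hx
      have : CliffordAlgebra.involute (e j.succ : Cl m) = -e j.succ := by simp [e]
      simp only [this, mul_neg]
      rw [e_anticomm (Fin.succ_ne_zero j)]
    | algebraMap r => simp [Algebra.commutes]
    | add x y _ _ hx hy => simp [mul_add, add_mul, hx, hy]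
    | mul x y _ _ hx hy => rw [map_mul, ← mul_assoc, hx, mul_assoc, hy, mul_assoc]
  rw [reflect, key, star_e, mul_neg, mul_assoc, e_sq]
  simp

theorem exists_components {m : ℕ} (c : Cl m) :
    ∃ a ∈ subCl m, ∃ b ∈ subCl m, c = a + star (e 0) * b := by
  induction c using CliffordAlgebra.left_induction with
  | algebraMap r => exact ⟨_, (subCl m).algebraMap_mem r, 0, (subCl m).zero_mem, by simp⟩
  | add x y hx hy =>
    obtain ⟨a, ha, b, hb, rfl⟩ := hx
    obtain ⟨a', ha', b', hb', rfl⟩ := hy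
    exact ⟨a + a', add_mem ha ha', b + b', add_mem hb hb', by rw [mul_add]; abel⟩
  | ι_mul x v hx =>
    obtain ⟨a, ha, b, hb, rfl⟩ := hx
    have hv : CliffordAlgebra.ι (quadForm m) v
        = v 0 • e 0 + ∑ j : Fin m, v j.succ • e j.succ := by
      rw [← Fin.sum_univ_succ (fun i => v i • (e i : Cl m))]
      conv_lhs => rw [pi_eq_sum_univ' v]
      simp [e, map_sum]
    set w : Cl m := ∑ j : Fin m, v j.succ • e j.succ with hw
    have hwm : w ∈ subCl m :=
      sum_mem fun j _ => (subCl m).smul_mem (Algebra.subset_adjoin ⟨j, rfl⟩) _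
    have hw0 : w * e 0 = -(e 0 * w) := by
      rw [hw, Finset.sum_mul, Finset.mul_sum, ← Finset.sum_neg_distrib]
      refine Finset.sum_congr rfl fun j _ => ?_
      rw [smul_mul_assoc, e_anticomm (Fin.succ_ne_zero j), mul_smul_comm, smul_neg]
    refine ⟨v 0 • b + w * a, add_mem ((subCl m).smul_mem hb _) (mul_mem hwm ha),
      -(v 0 • a) - w * b, sub_mem (neg_mem ((subCl m).smul_mem ha _)) (mul_mem hwm hb), ?_⟩
    have h0 : (e 0 : Cl m) * (e 0 * b) = -b := by rw [← mul_assoc, e_sq]; simp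
    have h1 : w * (e 0 * b) = -(e 0 * (w * b)) := by
      rw [← mul_assoc, hw0, neg_mul, mul_assoc]
    rw [hv, star_e]
    simp only [add_mul, mul_add, mul_sub, neg_mul, mul_neg, smul_mul_assoc, mul_smul_comm, h0, h1]
    simp only [smul_neg, neg_neg]
    abel

/-- `compA c` and `compB c` are the unique `a, b ∈ ℝ_{0,m}` with `c = ½ a + ½ \bar{e_0} b`. -/
theorem components_iff {m : ℕ} (c a b : Cl m) :
    (a ∈ subCl m ∧ b ∈ subCl m ∧ c = (1 / 2 : ℝ) • a + (1 / 2 : ℝ) • (star (e 0) * b)) ↔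
      (a = compA c ∧ b = compB c) := by
  have main : ∀ a b : Cl m, a ∈ subCl m → b ∈ subCl m →
      compA ((1 / 2 : ℝ) • a + (1 / 2 : ℝ) • (star (e 0) * b)) = a ∧
      compB ((1 / 2 : ℝ) • a + (1 / 2 : ℝ) • (star (e 0) * b)) = b := by
    intro a b ha hb
    have hf : reflect ((1 / 2 : ℝ) • a + (1 / 2 : ℝ) • (star (e 0) * b))
        = (1 / 2 : ℝ) • a - (1 / 2 : ℝ) • (star (e 0) * b) := by
      have hlin : ∀ x y : Cl m, ∀ s : ℝ, reflect (s • x + s • y) = s • reflect x + s • reflect y := by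
        intro x y s
        simp [reflect, mul_add, add_mul]
      have hneg : ∀ x : Cl m, reflect (-x) = -reflect x := by intro x; simp [reflect]
      rw [hlin, reflect_of_mem ha, star_e, neg_mul, hneg, reflect_e_zero_mul, reflect_of_mem hb]
      simp [sub_eq_add_neg]
    constructor
    · rw [compA, hf]
      rw [add_add_sub_cancel, ← add_smul]; norm_num
    · rw [compB, hf, add_sub_sub_cancel, ← add_smul]
      norm_num
      rw [star_e, neg_mul, mul_neg, ← mul_assoc, e_sq]; simp
  constructor
  · rintro ⟨ha, hb, rfl⟩
    exact ⟨(main a b ha hb).1.symm, (main a b ha hb).2.symm⟩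
  · rintro ⟨rfl, rfl⟩
    obtain ⟨a, ha, b, hb, hc⟩ := exists_components c
    have hc' : c = (1 / 2 : ℝ) • ((2 : ℝ) • a) + (1 / 2 : ℝ) • (star (e 0) * ((2 : ℝ) • b)) := by
      rw [hc, mul_smul_comm, smul_smul, smul_smul]; norm_num
    have h2 := main _ _ ((subCl m).smul_mem ha (2 : ℝ)) ((subCl m).smul_mem hb (2 : ℝ))
    rw [← hc'] at h2
    rw [h2.1, h2.2]
    exact ⟨(subCl m).smul_mem ha _, (subCl m).smul_mem hb _, hc'⟩

/-! ### The Cauchy kernel and the downstream potentials -/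

/-- The area `σ_n = 2 π^{n/2} / Γ(n/2)` of the unit sphere `S^{n-1}` in `ℝ^n`. -/
def sphereArea (n : ℕ) : ℝ := 2 * Real.pi ^ ((n : ℝ) / 2) / Real.Gamma ((n : ℝ) / 2)

/-- The point `(x_0, \underline{x})` of `ℝ^{m+1}`. -/
def point {m : ℕ} (x₀ : ℝ) (x : EuclideanSpace ℝ (Fin m)) : EuclideanSpace ℝ (Fin (m + 1)) :=
  WithLp.toLp 2 (Fin.cons x₀ x.ofLp)

/-- The Cauchy kernel `C_{-1}(x) = (1/σ_{m+1}) x \bar{e_0} / |x|^{m+1}`. -/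
def cauchyKernel (m : ℕ) (x : EuclideanSpace ℝ (Fin (m + 1))) : Cl m :=
  (1 / (sphereArea (m + 1) * ‖x‖ ^ (m + 1))) •
    (CliffordAlgebra.ι (quadForm m) x.ofLp * star (e 0))

/-- The partial derivative `∂_{x_α}` of a Clifford-valued function. -/
def partialDeriv {m : ℕ} (α : Fin (m + 1)) (F : EuclideanSpace ℝ (Fin (m + 1)) → Cl m)
    (x : EuclideanSpace ℝ (Fin (m + 1))) : Cl m :=
  lineDeriv ℝ F x (EuclideanSpace.single α 1)

/-- The conjugate Cauchy–Riemann operator `\bar D = ½ (∂_{x_0} - \bar{e_0} \underline{∂})`,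
where `\underline{∂} = ∑_{j=1}^m e_j ∂_{x_j}`. -/
def conjCR {m : ℕ} (F : EuclideanSpace ℝ (Fin (m + 1)) → Cl m)
    (x : EuclideanSpace ℝ (Fin (m + 1))) : Cl m :=
  (1 / 2 : ℝ) • (partialDeriv 0 F x
    - star (e 0) * ∑ j : Fin m, e j.succ * partialDeriv j.succ F x)

/-- The downstream potential `C_{-k-1} = \bar D^k C_{-1}`. -/
def potC (m k : ℕ) : EuclideanSpace ℝ (Fin (m + 1)) → Cl m := conjCR^[k] (cauchyKernel m)

/-- The component `A_{-k-1}` in `C_{-k-1} = ½ A_{-k-1} + ½ \bar{e_0} B_{-k-1}`. -/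
def potA (m k : ℕ) (x : EuclideanSpace ℝ (Fin (m + 1))) : Cl m := compA (potC m k x)

/-- The component `B_{-k-1}` in `C_{-k-1} = ½ A_{-k-1} + ½ \bar{e_0} B_{-k-1}`. -/
def potB (m k : ℕ) (x : EuclideanSpace ℝ (Fin (m + 1))) : Cl m := compB (potC m k x)

/-! ### Clifford-valued tempered distributions on `ℝ^m` -/

/-- Clifford-valued tempered distributions on `ℝ^m`, acting on scalar test functions. -/
abbrev CliffordDistrib (m : ℕ) : Type := 𝓢(EuclideanSpace ℝ (Fin m), ℝ) →L[ℝ] Cl m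

/-- `T` is the distributional limit of `F(x_0, ·)` as `x_0` tends along `l`
(`l = 𝓝[>] 0` for the upper, `l = 𝓝[<] 0` for the lower half-space). -/
def IsBoundaryValue {m : ℕ} (l : Filter ℝ) (F : EuclideanSpace ℝ (Fin (m + 1)) → Cl m)
    (T : CliffordDistrib m) : Prop :=
  ∀ φ : 𝓢(EuclideanSpace ℝ (Fin m), ℝ),
    (∀ᶠ x₀ in l, Integrable fun x : EuclideanSpace ℝ (Fin m) => φ x • F (point x₀ x)) ∧
    Tendsto (fun x₀ => ∫ x : EuclideanSpace ℝ (Fin m), φ x • F (point x₀ x)) l (𝓝 (T φ))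

/-- Left multiplication by a fixed Clifford number. -/
def mulLeftCLM {m : ℕ} (a : Cl m) : Cl m →L[ℝ] Cl m :=
  LinearMap.toContinuousLinearMap (LinearMap.mulLeft ℝ a)

/-- The Dirac operator `\underline{∂} = ∑_{j=1}^m e_j ∂_{x_j}` on distributions:
`⟨\underline{∂} T, φ⟩ = -∑_j e_j ⟨T, ∂_{x_j} φ⟩`. -/
def dirac {m : ℕ} (T : CliffordDistrib m) : CliffordDistrib m :=
  -∑ j : Fin m, mulLeftCLM (e j.succ) ∘L T ∘L
    LineDeriv.lineDerivOpCLM ℝ 𝓢(EuclideanSpace ℝ (Fin m), ℝ) (EuclideanSpace.single j (1 : ℝ))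

/-- The embedding `\underline{x} ↦ ∑_{j=1}^m x_j e_j` of `ℝ^m` into the Clifford algebra. -/
def vec (m : ℕ) : EuclideanSpace ℝ (Fin m) →L[ℝ] Cl m :=
  ∑ j : Fin m, (EuclideanSpace.proj j : EuclideanSpace ℝ (Fin m) →L[ℝ] ℝ).smulRight (e j.succ)

/-- The Dirac delta distribution on `ℝ^m`. -/
def delta (m : ℕ) : CliffordDistrib m :=
  ((BoundedContinuousFunction.evalCLM ℝ (0 : EuclideanSpace ℝ (Fin m))).comp
    (SchwartzMap.toBoundedContinuousFunctionCLM ℝ (EuclideanSpace ℝ (Fin m)) ℝ)).smulRight (1 : Cl m)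

theorem delta_apply (m : ℕ) (φ : 𝓢(EuclideanSpace ℝ (Fin m), ℝ)) :
    delta m φ = φ 0 • (1 : Cl m) := rfl

/-! ### The Hilbert kernel -/

/-- The truncated integral `∫_{|x| > ε} φ(x) ω / r^m dx`, with `r = |x|` and `ω = x / |x|`. -/
def truncatedPv {m : ℕ} (φ : 𝓢(EuclideanSpace ℝ (Fin m), ℝ)) (ε : ℝ) : EuclideanSpace ℝ (Fin m) :=
  ∫ x in {x : EuclideanSpace ℝ (Fin m) | ε < ‖x‖}, (φ x / ‖x‖ ^ m) • (‖x‖⁻¹ • x)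

/-- The principal value `⟨Pv ω / r^m, φ⟩ = lim_{ε → 0+} ∫_{|x| > ε} φ(x) ω / r^m dx`
(the limit exists, see `tendsto_truncatedPv`). -/
def pv {m : ℕ} (φ : 𝓢(EuclideanSpace ℝ (Fin m), ℝ)) : EuclideanSpace ℝ (Fin m) :=
  limUnder (𝓝[>] 0) (truncatedPv φ)

section PrincipalValue

variable {m : ℕ}

theorem integrable_majorant : Integrable fun x : EuclideanSpace ℝ (Fin m) =>
    ‖x‖ / ‖x‖ ^ m * (1 + ‖x‖ ^ 2)⁻¹ := by
  rcases Nat.eq_zero_or_pos m with rfl | hm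
  · refine (integrable_zero _ _ _).congr (Eventually.of_forall fun x => ?_)
    simp [Subsingleton.elim x 0]
  · have : NeZero m := ⟨hm.ne'⟩
    refine (integrable_fun_norm_addHaar (volume : Measure (EuclideanSpace ℝ (Fin m)))
      (f := fun y : ℝ => y / y ^ m * (1 + y ^ 2)⁻¹)).2 ?_
    refine (integrable_inv_one_add_sq.integrableOn (s := Ioi 0)).congr_fun ?_ measurableSet_Ioi
    intro y hy
    have hy0 : (y : ℝ) ≠ 0 := ne_of_gt hy
    obtain ⟨n, rfl⟩ : ∃ n, m = n + 1 := ⟨m - 1, by omega⟩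
    simp only [finrank_euclideanSpace, Fintype.card_fin, Nat.add_sub_cancel, smul_eq_mul]
    field_simp
    ring

theorem abs_sub_neg_le (φ : 𝓢(EuclideanSpace ℝ (Fin m), ℝ)) (x : EuclideanSpace ℝ (Fin m)) :
    |φ x - φ (-x)| ≤ 2 * (SchwartzMap.seminorm ℝ 0 1 φ + SchwartzMap.seminorm ℝ 1 0 φ)
      * (‖x‖ * (1 + ‖x‖ ^ 2)⁻¹) := by
  have h1 : |φ x - φ (-x)| ≤ SchwartzMap.seminorm ℝ 0 1 φ * (2 * ‖x‖) := by
    have := Convex.norm_image_sub_le_of_norm_fderiv_le (𝕜 := ℝ) (f := φ) (s := Set.univ)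
      (C := SchwartzMap.seminorm ℝ 0 1 φ) (x := -x) (y := x)
      (fun y _ => φ.differentiableAt) (fun y _ => by
        have := SchwartzMap.le_seminorm ℝ 0 1 φ y
        rw [pow_zero, one_mul, norm_iteratedFDeriv_one] at this
        exact this) convex_univ (mem_univ _) (mem_univ _)
    rw [Real.norm_eq_abs] at this
    refine this.trans (le_of_eq ?_)
    rw [sub_neg_eq_add, ← two_smul ℝ x, norm_smul]
    norm_num
  have h2 : ‖x‖ * |φ x - φ (-x)| ≤ 2 * SchwartzMap.seminorm ℝ 1 0 φ := by
    have a := SchwartzMap.norm_pow_mul_le_seminorm ℝ φ 1 x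
    have b := SchwartzMap.norm_pow_mul_le_seminorm ℝ φ 1 (-x)
    rw [norm_neg] at b
    simp only [pow_one, Real.norm_eq_abs] at a b
    nlinarith [abs_sub (φ x) (φ (-x)), norm_nonneg x]
  have hpos : (0 : ℝ) < 1 + ‖x‖ ^ 2 := by positivity
  rw [← mul_assoc, ← div_eq_mul_inv, le_div_iff₀ hpos]
  nlinarith [norm_nonneg x, mul_le_mul_of_nonneg_left h2 (norm_nonneg x)]

/-- The odd part of the integrand of the principal value. -/
def pvIntegrand (φ : 𝓢(EuclideanSpace ℝ (Fin m), ℝ)) (x : EuclideanSpace ℝ (Fin m)) :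
    EuclideanSpace ℝ (Fin m) := ((φ x - φ (-x)) / ‖x‖ ^ m) • (‖x‖⁻¹ • x)

theorem norm_pvIntegrand_le (φ : 𝓢(EuclideanSpace ℝ (Fin m), ℝ)) (x : EuclideanSpace ℝ (Fin m)) :
    ‖pvIntegrand φ x‖ ≤ 2 * (SchwartzMap.seminorm ℝ 0 1 φ + SchwartzMap.seminorm ℝ 1 0 φ)
      * (‖x‖ / ‖x‖ ^ m * (1 + ‖x‖ ^ 2)⁻¹) := by
  have h1 : ‖‖x‖⁻¹ • x‖ ≤ 1 := by
    rw [norm_smul, norm_inv, norm_norm]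
    exact inv_mul_le_one
  have h2 : ‖pvIntegrand φ x‖ ≤ |φ x - φ (-x)| / ‖x‖ ^ m := by
    rw [pvIntegrand, norm_smul, Real.norm_eq_abs, abs_div, abs_of_nonneg (by positivity : 0 ≤ ‖x‖ ^ m)]
    exact mul_le_of_le_one_right (by positivity) h1
  refine h2.trans ?_
  have := div_le_div_of_nonneg_right (abs_sub_neg_le φ x) (by positivity : 0 ≤ ‖x‖ ^ m)
  refine this.trans (le_of_eq ?_)
  ring

theorem integrable_pvIntegrand (φ : 𝓢(EuclideanSpace ℝ (Fin m), ℝ)) :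
    Integrable (pvIntegrand φ) := by
  refine (integrable_majorant.const_mul _).mono' ?_ (Eventually.of_forall (norm_pvIntegrand_le φ))
  have := φ.continuous.measurable
  unfold pvIntegrand
  exact Measurable.aestronglyMeasurable (by fun_prop)

theorem truncatedPv_eq (φ : 𝓢(EuclideanSpace ℝ (Fin m), ℝ)) {ε : ℝ} (hε : 0 < ε) :
    truncatedPv φ ε =
      (1 / 2 : ℝ) • ∫ x in {x : EuclideanSpace ℝ (Fin m) | ε < ‖x‖}, pvIntegrand φ x := by
  set S : Set (EuclideanSpace ℝ (Fin m)) := {x | ε < ‖x‖} with hS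
  have hSm : MeasurableSet S := measurableSet_lt measurable_const measurable_norm
  have hbd : ∀ ψ : EuclideanSpace ℝ (Fin m) → ℝ, Measurable ψ → Integrable ψ →
      IntegrableOn (fun x => (ψ x / ‖x‖ ^ m) • (‖x‖⁻¹ • x)) S := by
    intro ψ hψm hψ
    refine ((hψ.norm.mul_const (ε ^ m)⁻¹).integrableOn (s := S)).mono' ?_ ?_
    · exact Measurable.aestronglyMeasurable (by fun_prop)
    · refine (ae_restrict_iff' hSm).2 (Eventually.of_forall fun x hx => ?_)
      have hx' : ε < ‖x‖ := hx
      rw [norm_smul, norm_smul, norm_inv, norm_norm, norm_div, norm_pow, norm_norm, div_eq_mul_inv]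
      have h1 : ‖x‖⁻¹ * ‖x‖ ≤ 1 := inv_mul_le_one
      have h2 : (‖x‖ ^ m)⁻¹ ≤ (ε ^ m)⁻¹ := by gcongr
      calc ‖ψ x‖ * (‖x‖ ^ m)⁻¹ * (‖x‖⁻¹ * ‖x‖) ≤ ‖ψ x‖ * (‖x‖ ^ m)⁻¹ :=
            mul_le_of_le_one_right (by positivity) h1
        _ ≤ _ := by gcongr
  have hi1 := hbd φ φ.continuous.measurable φ.integrable
  have hi2 := hbd (fun x => φ (-x)) (φ.continuous.measurable.comp measurable_neg)
    φ.integrable.comp_neg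
  have hsub : ∫ x in S, pvIntegrand φ x = truncatedPv φ ε
      - ∫ x in S, (φ (-x) / ‖x‖ ^ m) • (‖x‖⁻¹ • x) := by
    rw [truncatedPv, ← integral_sub hi1 hi2]
    refine integral_congr_ae (Eventually.of_forall fun x => ?_)
    simp only [pvIntegrand, sub_div, sub_smul]
  have hneg : ∫ x in S, (φ (-x) / ‖x‖ ^ m) • (‖x‖⁻¹ • x) = -truncatedPv φ ε := by
    rw [truncatedPv, ← integral_indicator hSm, ← integral_indicator hSm, ← integral_neg,
      ← integral_neg_eq_self]
    refine integral_congr_ae (Eventually.of_forall fun x => ?_)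
    by_cases hx : x ∈ S
    · have hx' : -x ∈ S := by simpa [hS] using hx
      simp [hx, hx']
    · have hx' : -x ∉ S := by simpa [hS] using hx
      simp [hx, hx']
  rw [hsub, hneg, sub_neg_eq_add, ← two_smul ℝ, smul_smul]
  norm_num

theorem tendsto_truncatedPv_integral (φ : 𝓢(EuclideanSpace ℝ (Fin m), ℝ)) :
    Tendsto (truncatedPv φ) (𝓝[>] 0) (𝓝 ((1 / 2 : ℝ) • ∫ x, pvIntegrand φ x)) := by
  have key : Tendsto (fun ε : ℝ => (1 / 2 : ℝ) •
      ∫ x in {x : EuclideanSpace ℝ (Fin m) | ε < ‖x‖}, pvIntegrand φ x) (𝓝[>] 0)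
      (𝓝 ((1 / 2 : ℝ) • ∫ x, pvIntegrand φ x)) := by
    refine Tendsto.const_smul ?_ _
    have hm : ∀ ε : ℝ, MeasurableSet {x : EuclideanSpace ℝ (Fin m) | ε < ‖x‖} := fun ε =>
      measurableSet_lt measurable_const measurable_norm
    simp_rw [← integral_indicator (hm _)]
    refine tendsto_integral_filter_of_dominated_convergence (fun x => ‖pvIntegrand φ x‖) ?_ ?_
      (integrable_pvIntegrand φ).norm ?_
    · exact Eventually.of_forall fun ε =>
        (integrable_pvIntegrand φ).aestronglyMeasurable.indicator (hm ε)
    · exact Eventually.of_forall fun ε => Eventually.of_forall fun x => norm_indicator_le_norm_self _ _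
    · refine Eventually.of_forall fun x => ?_
      by_cases hx : x = 0
      · subst hx
        have : pvIntegrand φ 0 = 0 := by simp [pvIntegrand]
        rw [this]
        refine tendsto_const_nhds.congr fun ε => ?_
        simp [Set.indicator_apply, this]
      · refine tendsto_const_nhds.congr' ?_
        have : Iio ‖x‖ ∈ 𝓝[>] (0 : ℝ) :=
          mem_nhdsWithin_of_mem_nhds (Iio_mem_nhds (norm_pos_iff.2 hx))
        filter_upwards [this] with ε hε
        rw [Set.indicator_of_mem]
        exact hε
  refine key.congr' ?_
  filter_upwards [self_mem_nhdsWithin] with ε hε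
  exact (truncatedPv_eq φ hε).symm

theorem pv_eq (φ : 𝓢(EuclideanSpace ℝ (Fin m), ℝ)) :
    pv φ = (1 / 2 : ℝ) • ∫ x, pvIntegrand φ x :=
  (tendsto_truncatedPv_integral φ).limUnder_eq

theorem tendsto_truncatedPv (φ : 𝓢(EuclideanSpace ℝ (Fin m), ℝ)) :
    Tendsto (truncatedPv φ) (𝓝[>] 0) (𝓝 (pv φ)) :=
  pv_eq φ ▸ tendsto_truncatedPv_integral φ

end PrincipalValue

/-- The principal value as a continuous functional on the Schwartz space. -/
def pvCLM (m : ℕ) : 𝓢(EuclideanSpace ℝ (Fin m), ℝ) →L[ℝ] EuclideanSpace ℝ (Fin m) :=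
  SchwartzMap.mkCLMtoNormedSpace (𝕜 := ℝ) (σ := RingHom.id ℝ) (fun φ => pv φ)
    (by
      intro f g
      rw [pv_eq, pv_eq, pv_eq, ← smul_add,
        ← integral_add (integrable_pvIntegrand f) (integrable_pvIntegrand g)]
      congr 1
      refine integral_congr_ae (Eventually.of_forall fun x => ?_)
      simp only [pvIntegrand, add_apply, ← add_smul]
      congr 1
      ring)
    (by
      intro a f
      have h : ∫ x, pvIntegrand (a • f) x = a • ∫ x, pvIntegrand f x := by
        rw [← integral_smul]
        refine integral_congr_ae (Eventually.of_forall fun x => ?_)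
        change ((a * f x - a * f (-x)) / ‖x‖ ^ m) • (‖x‖⁻¹ • x)
          = a • (((f x - f (-x)) / ‖x‖ ^ m) • (‖x‖⁻¹ • x))
        rw [smul_smul a, ← mul_sub, mul_div_assoc]
      rw [pv_eq, pv_eq, RingHom.id_apply, h, smul_comm])
    (by
      refine ⟨{(0, 1), (1, 0)},
        2 * ∫ x : EuclideanSpace ℝ (Fin m), ‖x‖ / ‖x‖ ^ m * (1 + ‖x‖ ^ 2)⁻¹, ?_, fun f => ?_⟩
      · have : 0 ≤ ∫ x : EuclideanSpace ℝ (Fin m), ‖x‖ / ‖x‖ ^ m * (1 + ‖x‖ ^ 2)⁻¹ :=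
          integral_nonneg fun x => by positivity
        positivity
      · have hJ : 0 ≤ ∫ x : EuclideanSpace ℝ (Fin m), ‖x‖ / ‖x‖ ^ m * (1 + ‖x‖ ^ 2)⁻¹ :=
          integral_nonneg fun x => by positivity
        have h := norm_integral_le_of_norm_le (integrable_majorant.const_mul _)
          (Eventually.of_forall (norm_pvIntegrand_le f))
        rw [integral_const_mul] at h
        have ha : SchwartzMap.seminorm ℝ 0 1 f ≤
            (({(0, 1), (1, 0)} : Finset (ℕ × ℕ)).sup
              (schwartzSeminormFamily ℝ (EuclideanSpace ℝ (Fin m)) ℝ)) f :=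
          Seminorm.le_def.1 (Finset.le_sup (f := schwartzSeminormFamily ℝ
            (EuclideanSpace ℝ (Fin m)) ℝ) (by simp : (0, 1) ∈ _)) f
        have hb : SchwartzMap.seminorm ℝ 1 0 f ≤
            (({(0, 1), (1, 0)} : Finset (ℕ × ℕ)).sup
              (schwartzSeminormFamily ℝ (EuclideanSpace ℝ (Fin m)) ℝ)) f :=
          Seminorm.le_def.1 (Finset.le_sup (f := schwartzSeminormFamily ℝ
            (EuclideanSpace ℝ (Fin m)) ℝ) (by simp : (1, 0) ∈ _)) f
        rw [pv_eq, norm_smul, Real.norm_of_nonneg (by norm_num : (0 : ℝ) ≤ 1 / 2)]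
        nlinarith [mul_le_mul_of_nonneg_right (add_le_add ha hb) hJ])

theorem pvCLM_apply (m : ℕ) (φ : 𝓢(EuclideanSpace ℝ (Fin m), ℝ)) : pvCLM m φ = pv φ := rfl

/-- The Hilbert kernel `H = -(2/σ_{m+1}) Pv ω / r^m` on `ℝ^m`. -/
def hilbertKernel (m : ℕ) : CliffordDistrib m :=
  (-(2 / sphereArea (m + 1))) • (vec m ∘L pvCLM m)

/-! ### Finite part distributions -/

section FinitePart

variable {F : Type*} [NormedAddCommGroup F] [NormedSpace ℝ F]

/-- Hadamard regularization of the divergent integral `∫_0^∞ r^μ ψ(r) dr` for an integer `μ`: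
the integral over `(ε, ∞)`, freed of the terms that diverge as `ε → 0+`. -/
def hadamardReg (μ : ℤ) (ψ : ℝ → F) (ε : ℝ) : F :=
  (∫ r in Ioi ε, r ^ μ • ψ r) +
    ∑ k ∈ Finset.range (-μ).toNat,
      ((if μ + k + 1 = 0 then Real.log ε else ε ^ (μ + k + 1) / ((μ : ℝ) + k + 1)) /
        (k.factorial : ℝ)) • iteratedDeriv k ψ 0

/-- `⟨Fp r_+^μ, ψ⟩`, Hadamard's finite part of `∫_0^∞ r^μ ψ(r) dr`. -/
def finitePart (μ : ℤ) (ψ : ℝ → F) : F := limUnder (𝓝[>] 0) (hadamardReg μ ψ)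

/-- The limit that defines `⟨Fp r_+^μ, ψ⟩` exists. -/
def FinitePartExists (μ : ℤ) (ψ : ℝ → F) : Prop :=
  ∃ L : F, Tendsto (hadamardReg μ ψ) (𝓝[>] 0) (𝓝 L)

end FinitePart

/-- The spherical mean `Σ^{(0)}[φ](r) = (1/σ_m) ∫_{S^{m-1}} φ(rω) dS(ω)`. -/
def sphericalMean0 {m : ℕ} (φ : 𝓢(EuclideanSpace ℝ (Fin m), ℝ)) (r : ℝ) : Cl m :=
  (1 / sphereArea m) • ∫ ω : Metric.sphere (0 : EuclideanSpace ℝ (Fin m)) 1,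
    φ (r • ω.1) • (1 : Cl m) ∂(volume : Measure (EuclideanSpace ℝ (Fin m))).toSphere

/-- The spherical mean `Σ^{(1)}[φ](r) = (1/σ_m) ∫_{S^{m-1}} ω φ(rω) dS(ω)`. -/
def sphericalMean1 {m : ℕ} (φ : 𝓢(EuclideanSpace ℝ (Fin m), ℝ)) (r : ℝ) : Cl m :=
  (1 / sphereArea m) • ∫ ω : Metric.sphere (0 : EuclideanSpace ℝ (Fin m)) 1,
    φ (r • ω.1) • vec m ω.1 ∂(volume : Measure (EuclideanSpace ℝ (Fin m))).toSphere

/-- The distribution `T_lam = Fp r^lam` on `ℝ^m`: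
`⟨T_lam, φ⟩ = σ_m ⟨Fp r_+^{lam+m-1}, Σ^{(0)}[φ]⟩`. -/
def fpT {m : ℕ} (lam : ℤ) (φ : 𝓢(EuclideanSpace ℝ (Fin m), ℝ)) : Cl m :=
  sphereArea m • finitePart (lam + m - 1) (sphericalMean0 φ)

/-- The distribution `U_lam = Fp r^lam ω` on `ℝ^m`:
`⟨U_lam, φ⟩ = σ_m ⟨Fp r_+^{lam+m-1}, Σ^{(1)}[φ]⟩`. -/
def fpU {m : ℕ} (lam : ℤ) (φ : 𝓢(EuclideanSpace ℝ (Fin m), ℝ)) : Cl m :=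
  sphereArea m • finitePart (lam + m - 1) (sphericalMean1 φ)

/-- `T = c Fp r^lam`, the finite parts on the right-hand side being convergent. -/
def EqFpT {m : ℕ} (T : CliffordDistrib m) (c : ℝ) (lam : ℤ) : Prop :=
  ∀ φ : 𝓢(EuclideanSpace ℝ (Fin m), ℝ),
    FinitePartExists (lam + m - 1) (sphericalMean0 φ) ∧ T φ = c • fpT lam φ

/-- `T = c Fp r^lam ω`, the finite parts on the right-hand side being convergent. -/
def EqFpU {m : ℕ} (T : CliffordDistrib m) (c : ℝ) (lam : ℤ) : Prop :=
  ∀ φ : 𝓢(EuclideanSpace ℝ (Fin m), ℝ),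
    FinitePartExists (lam + m - 1) (sphericalMean1 φ) ∧ T φ = c • fpU lam φ

end Downstream

end

/-! The Cauchy kernel is monogenic off the origin, i.e. `∂_{x_0} C = -\bar{e_0} \underline{∂} C`,
and differentiation in `x_0` preserves this. On monogenic functions `\bar D` is therefore at once
`∂_{x_0}` and `-\bar{e_0} \underline{∂}`. Left multiplication by `\bar{e_0} e_j` exchanges the two
components, whence `A_{-k-2} = -\underline{∂} B_{-k-1}` and `B_{-k-2} = -\underline{∂} A_{-k-1}`
(`potA_succ`, `potB_succ`). On a hyperplane `x_0 = const ≠ 0` the kernels are smooth and bounded, so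
`\underline{∂}` can be moved onto the test function, and distributional limits commute with it
(`IsBoundaryValue.dirac`). All boundary values then follow from those of the Poisson kernel
`A_{-1}`, which tends to `±δ` (`isBoundaryValue_potA_zero`), and of the conjugate Poisson kernel
`B_{-1}`, which tends to `H` from both sides (`isBoundaryValue_potB_zero`).

For the explicit forms, the Dirac operator is transported to spherical means. Rotation invariance of
the sphere gives, up to a factor `r`, `∑ e_j Σ^{(1)}[∂_j φ] = -(Σ^{(0)}[φ])'` and `∑ e_j Σ^{(0)}[∂_j
φ] = (Σ^{(1)}[φ])' + ((m-1)/r) Σ^{(1)}[φ]`. Integration by parts in the Hadamard finite part of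
`r^{-n}` then multiplies by `n`, respectively by `-(m-1+n)`, and raises the order by one
(`tendsto_hadamardReg_sub`, `dirac_finitePart`). The only possible correction is a multiple of the
`n`-th derivative of the mean at the origin; it vanishes because `Σ^{(0)}` is even and used with odd
`n`, while `Σ^{(1)}` is odd and used with even `n`. Starting from `H`, where `n = 1` and the finite
part is the principal value, the odd factors build `(2ℓ-1)!!` and the even ones `(m+1)(m+3)⋯`. -/

noncomputable section

open scoped ContDiff

namespace Downstream

/-! ### Homogeneous functions smooth away from the origin -/

section Homogeneous

variable {V W W' : Type*} [NormedAddCommGroup V] [NormedSpace ℝ V]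
  [NormedAddCommGroup W] [NormedSpace ℝ W] [NormedAddCommGroup W'] [NormedSpace ℝ W']

/-- `F` is smooth on `V \ {0}` and positively homogeneous of degree `-d` there. -/
structure HomogSmooth (d : ℕ) (F : V → W) : Prop where
  smooth : ContDiffOn ℝ ∞ F {0}ᶜ
  homog : ∀ t : ℝ, 0 < t → ∀ x : V, x ≠ 0 → F (t • x) = (t ^ d)⁻¹ • F x

namespace HomogSmooth

variable {d : ℕ} {F G : V → W}

theorem contDiffAt (h : HomogSmooth d F) {x : V} (hx : x ≠ 0) : ContDiffAt ℝ ∞ F x :=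
  h.smooth.contDiffAt (isOpen_compl_singleton.mem_nhds hx)

theorem differentiableAt (h : HomogSmooth d F) {x : V} (hx : x ≠ 0) : DifferentiableAt ℝ F x :=
  (h.contDiffAt hx).differentiableAt (by simp)

theorem congr (h : HomogSmooth d F) (hFG : ∀ x ≠ 0, G x = F x) : HomogSmooth d G where
  smooth := h.smooth.congr fun x hx => hFG x hx
  homog t ht x hx := by
    rw [hFG x hx, hFG _ (smul_ne_zero ht.ne' hx), h.homog t ht x hx]

theorem clm_comp (h : HomogSmooth d F) (L : W →L[ℝ] W') : HomogSmooth d (fun x => L (F x)) where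
  smooth := L.contDiff.comp_contDiffOn h.smooth
  homog t ht x hx := by rw [h.homog t ht x hx, map_smul]

/-- Differentiating `F (t • y) = t^{-d} F y` at `x` produces an extra factor `t` on the left, hence
degree `-(d+1)`. The identity is available near `x` because `x ≠ 0`. -/
theorem fderiv_apply (h : HomogSmooth d F) (v : V) :
    HomogSmooth (d + 1) (fun x => fderiv ℝ F x v) where
  smooth := (h.smooth.fderiv_of_isOpen isOpen_compl_singleton (by simp)).clm_apply contDiffOn_const
  homog t ht x hx := by
    have h1 : (fun y => F (t • y)) =ᶠ[𝓝 x] fun y => (t ^ d)⁻¹ • F y := by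
      filter_upwards [isOpen_compl_singleton.mem_nhds hx] with y hy using h.homog t ht y hy
    have h2 : HasFDerivAt (fun y => F (t • y))
        ((fderiv ℝ F (t • x)).comp (t • ContinuousLinearMap.id ℝ V)) x :=
      (h.differentiableAt (smul_ne_zero ht.ne' hx)).hasFDerivAt.comp x
        ((hasFDerivAt_id x).const_smul t)
    have h3 := ((h.differentiableAt hx).hasFDerivAt.const_smul ((t ^ d)⁻¹)).congr_of_eventuallyEq h1
    have h4 := congrArg (fun L : V →L[ℝ] W => L v) (h2.unique h3)
    simp only [ContinuousLinearMap.comp_apply, smul_apply,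
      ContinuousLinearMap.id_apply, map_smul] at h4
    rw [pow_succ, mul_inv, mul_comm, mul_smul, ← h4, smul_smul, inv_mul_cancel₀ ht.ne', one_smul]

/-- Compactness bounds `F` on the unit sphere, and homogeneity spreads the bound. -/
theorem exists_norm_le [FiniteDimensional ℝ V] (h : HomogSmooth d F) :
    ∃ C, 0 ≤ C ∧ ∀ x ≠ 0, ‖F x‖ ≤ C * (‖x‖ ^ d)⁻¹ := by
  have : ProperSpace V := FiniteDimensional.proper ℝ V
  obtain ⟨C, hC⟩ := (isCompact_sphere (0 : V) 1).exists_bound_of_continuousOn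
    (f := F) (h.smooth.continuousOn.mono fun x hx => by
      rintro rfl; simp at hx)
  -- If `V = 0` the sphere is empty and `C` could be negative.
  refine ⟨max C 0, le_max_right _ _, fun x hx => ?_⟩
  have hn : 0 < ‖x‖ := norm_pos_iff.2 hx
  have hu : ‖x‖⁻¹ • x ∈ Metric.sphere (0 : V) 1 := by
    simp [norm_smul, hn.ne']
  have hx' : F x = (‖x‖ ^ d)⁻¹ • F (‖x‖⁻¹ • x) := by
    rw [← h.homog _ hn _ (smul_ne_zero (inv_ne_zero hn.ne') hx), smul_smul,
      mul_inv_cancel₀ hn.ne', one_smul]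
  rw [hx', norm_smul, norm_inv, norm_pow, norm_norm, mul_comm]
  gcongr
  exact (hC _ hu).trans (le_max_left _ _)

end HomogSmooth

end Homogeneous

/-! ### Hyperplanes `x_0 = const` -/

section Point

variable {m : ℕ}

/-- The injection `\underline{x} ↦ (0, \underline{x})`. -/
def pointCLM (m : ℕ) : EuclideanSpace ℝ (Fin m) →L[ℝ] EuclideanSpace ℝ (Fin (m + 1)) :=
  LinearMap.toContinuousLinearMap
    { toFun := point 0
      map_add' := fun x y => by
        ext i
        refine Fin.cases ?_ (fun j => ?_) i <;> simp [point]
      map_smul' := fun c x => by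
        ext i
        refine Fin.cases ?_ (fun j => ?_) i <;> simp [point] }

theorem point_eq (x₀ : ℝ) (x : EuclideanSpace ℝ (Fin m)) :
    point x₀ x = EuclideanSpace.single 0 x₀ + pointCLM m x := by
  ext i
  refine Fin.cases ?_ (fun j => ?_) i <;> simp [point, pointCLM]

theorem pointCLM_single (j : Fin m) :
    pointCLM m (EuclideanSpace.single j 1) = EuclideanSpace.single j.succ 1 := by
  ext i
  refine Fin.cases ?_ (fun k => ?_) i
  · simp [point, pointCLM]
  · simp [point, pointCLM, Pi.single_apply]

theorem hasFDerivAt_point (x₀ : ℝ) (x : EuclideanSpace ℝ (Fin m)) :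
    HasFDerivAt (point x₀) (pointCLM m) x := by
  have : (point x₀ : EuclideanSpace ℝ (Fin m) → _)
      = fun x => EuclideanSpace.single 0 x₀ + pointCLM m x := funext (point_eq x₀)
  rw [this]
  exact (pointCLM m).hasFDerivAt.const_add _

theorem continuous_point (x₀ : ℝ) : Continuous (point x₀ : EuclideanSpace ℝ (Fin m) → _) :=
  continuous_iff_continuousAt.2 fun x => (hasFDerivAt_point x₀ x).continuousAt

theorem norm_point_sq (x₀ : ℝ) (x : EuclideanSpace ℝ (Fin m)) :
    ‖point x₀ x‖ ^ 2 = x₀ ^ 2 + ‖x‖ ^ 2 := by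
  simp [EuclideanSpace.norm_sq_eq, Fin.sum_univ_succ, point]

theorem abs_le_norm_point (x₀ : ℝ) (x : EuclideanSpace ℝ (Fin m)) : |x₀| ≤ ‖point x₀ x‖ :=
  abs_le_of_sq_le_sq' (by rw [norm_point_sq]; nlinarith [sq_nonneg ‖x‖]) (norm_nonneg _) |> abs_le.2

theorem norm_le_norm_point (x₀ : ℝ) (x : EuclideanSpace ℝ (Fin m)) : ‖x‖ ≤ ‖point x₀ x‖ := by
  refine le_of_sq_le_sq ?_ (norm_nonneg _)
  rw [norm_point_sq]; nlinarith [sq_nonneg x₀]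

theorem point_ne_zero {x₀ : ℝ} (h : x₀ ≠ 0) (x : EuclideanSpace ℝ (Fin m)) : point x₀ x ≠ 0 := by
  rw [← norm_pos_iff]
  exact (abs_pos.2 h).trans_le (abs_le_norm_point x₀ x)

variable {W : Type*} [NormedAddCommGroup W] [NormedSpace ℝ W]

theorem HomogSmooth.continuous_comp_point {d : ℕ} {F : EuclideanSpace ℝ (Fin (m + 1)) → W}
    (h : HomogSmooth d F) {x₀ : ℝ} (hx₀ : x₀ ≠ 0) : Continuous fun x => F (point x₀ x) :=
  h.smooth.continuousOn.comp_continuous (continuous_point x₀) fun x => point_ne_zero hx₀ x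

/-- Since `|(x_0, x)| ≥ |x_0|`, the kernel is bounded by `C |x_0|^{-d}` on the hyperplane. No decay
of `F` is needed, so the same argument serves all derivatives. -/
theorem HomogSmooth.integrable_smul {d : ℕ} {F : EuclideanSpace ℝ (Fin (m + 1)) → W}
    (h : HomogSmooth d F) {x₀ : ℝ} (hx₀ : x₀ ≠ 0) (φ : 𝓢(EuclideanSpace ℝ (Fin m), ℝ)) :
    Integrable fun x => φ x • F (point x₀ x) := by
  obtain ⟨C, hC, hb⟩ := h.exists_norm_le
  refine (φ.integrable.norm.mul_const (C * (|x₀| ^ d)⁻¹)).mono'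
    (φ.continuous.smul (h.continuous_comp_point hx₀)).aestronglyMeasurable
    (Eventually.of_forall fun x => ?_)
  rw [norm_smul]
  have h0 : 0 < |x₀| := abs_pos.2 hx₀
  have h1 : (‖point x₀ x‖ ^ d)⁻¹ ≤ (|x₀| ^ d)⁻¹ := by
    gcongr
    exact abs_le_norm_point x₀ x
  exact mul_le_mul_of_nonneg_left ((hb _ (point_ne_zero hx₀ x)).trans
    (mul_le_mul_of_nonneg_left h1 hC)) (norm_nonneg _)

/-- The direction `e_{j+1}` is tangent to the hyperplane, so this is integration by parts for the
slice `x ↦ F (x_0, x)` on `ℝ^m`. -/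
theorem HomogSmooth.integral_smul_fderiv {d : ℕ} {F : EuclideanSpace ℝ (Fin (m + 1)) → W}
    (h : HomogSmooth d F) {x₀ : ℝ} (hx₀ : x₀ ≠ 0) (φ : 𝓢(EuclideanSpace ℝ (Fin m), ℝ))
    (j : Fin m) :
    ∫ x, φ x • fderiv ℝ F (point x₀ x) (EuclideanSpace.single j.succ 1)
      = -∫ x, (∂_{EuclideanSpace.single j (1 : ℝ)} φ) x • F (point x₀ x) := by
  have hd : ∀ x, HasFDerivAt (fun x => F (point x₀ x))
      ((fderiv ℝ F (point x₀ x)).comp (pointCLM m)) x := fun x =>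
    (h.differentiableAt (point_ne_zero hx₀ x)).hasFDerivAt.comp x (hasFDerivAt_point x₀ x)
  have hv : ∀ x, fderiv ℝ (fun x => F (point x₀ x)) x (EuclideanSpace.single j 1)
      = fderiv ℝ F (point x₀ x) (EuclideanSpace.single j.succ 1) := fun x => by
    rw [(hd x).fderiv, ContinuousLinearMap.comp_apply, pointCLM_single]
  simp_rw [SchwartzMap.lineDerivOp_apply_eq_fderiv, ← hv]
  refine integral_smul_fderiv_eq_neg_fderiv_smul_of_integrable ?_ ?_ (h.integrable_smul hx₀ φ)
    (fun x _ => φ.differentiableAt) (fun x _ => (hd x).differentiableAt)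
  · simpa only [SchwartzMap.lineDerivOp_apply_eq_fderiv] using
      h.integrable_smul hx₀ (∂_{EuclideanSpace.single j (1 : ℝ)} φ)
  · simp_rw [hv]
    exact (h.fderiv_apply _).integrable_smul hx₀ φ

end Point

/-! ### Boundary values and the Dirac operator -/

section Boundary

variable {m : ℕ}

theorem mulLeftCLM_apply (a c : Cl m) : mulLeftCLM a c = a * c := rfl

theorem dirac_apply (T : CliffordDistrib m) (φ : 𝓢(EuclideanSpace ℝ (Fin m), ℝ)) :
    dirac T φ = -∑ j : Fin m, e j.succ * T (∂_{EuclideanSpace.single j (1 : ℝ)} φ) := by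
  simp [dirac, mulLeftCLM_apply, LineDeriv.lineDerivOpCLM_apply]

theorem dirac_neg (T : CliffordDistrib m) : dirac (-T) = -dirac T := by
  ext φ
  simp [dirac_apply]

/-- For a fixed `φ` the derivatives pass to the test function, and the limit of `G` is used on the
finitely many `∂_j φ`; no uniformity in `φ` is required. -/
theorem IsBoundaryValue.dirac {l : Filter ℝ} (hl : ∀ᶠ x₀ in l, x₀ ≠ 0) {d : ℕ}
    {F G : EuclideanSpace ℝ (Fin (m + 1)) → Cl m} (hG : HomogSmooth d G)
    (hF : ∀ x ≠ 0, F x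
      = -∑ j : Fin m, e j.succ * fderiv ℝ G x (EuclideanSpace.single j.succ 1))
    {T : CliffordDistrib m} (hT : IsBoundaryValue l G T) :
    IsBoundaryValue l F (-Downstream.dirac T) := by
  intro φ
  have hint : ∀ x₀ ≠ 0, ∀ j : Fin m, Integrable fun x =>
      φ x • (e j.succ * fderiv ℝ G (point x₀ x) (EuclideanSpace.single j.succ 1)) :=
    fun x₀ hx₀ j => ((hG.fderiv_apply _).clm_comp (mulLeftCLM (e j.succ))).integrable_smul hx₀ φ
  have hFeq : ∀ x₀ ≠ 0, (fun x => φ x • F (point x₀ x)) = fun x => -∑ j : Fin m,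
      φ x • (e j.succ * fderiv ℝ G (point x₀ x) (EuclideanSpace.single j.succ 1)) := by
    intro x₀ hx₀
    ext1 x
    rw [hF _ (point_ne_zero hx₀ x), smul_neg, Finset.smul_sum]
  refine ⟨hl.mono fun x₀ hx₀ => ?_, ?_⟩
  · rw [hFeq x₀ hx₀]
    exact (integrable_finsetSum _ fun j _ => hint x₀ hx₀ j).neg
  -- The minus sign in the definition of the distributional derivative cancels the one in front of
  -- `dirac T`.
  · have hval : (-Downstream.dirac T) φ
        = ∑ j : Fin m, e j.succ * T (∂_{EuclideanSpace.single j (1 : ℝ)} φ) := by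
      rw [neg_apply, dirac_apply, neg_neg]
    rw [hval]
    have := tendsto_finsetSum Finset.univ fun (j : Fin m) _ =>
      ((mulLeftCLM (e j.succ : Cl m)).continuous.tendsto _).comp
        (hT (∂_{EuclideanSpace.single j (1 : ℝ)} φ)).2
    refine this.congr' (hl.mono fun x₀ hx₀ => ?_)
    simp only [Function.comp_apply]
    rw [hFeq x₀ hx₀, integral_neg, integral_finsetSum _ fun j _ => hint x₀ hx₀ j,
      ← Finset.sum_neg_distrib]
    refine Finset.sum_congr rfl fun j _ => ?_
    have h1 := ContinuousLinearMap.integral_comp_comm (mulLeftCLM (e j.succ : Cl m))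
      ((hG.fderiv_apply (EuclideanSpace.single j.succ 1)).integrable_smul hx₀ φ)
    simp only [mulLeftCLM_apply, mul_smul_comm] at h1
    rw [h1, hG.integral_smul_fderiv hx₀]
    simp [mulLeftCLM_apply]

end Boundary

section

variable {m : ℕ}

/-! ### The components as linear maps -/

/-- `reflect` as a continuous linear map. -/
def reflectCLM (m : ℕ) : Cl m →L[ℝ] Cl m :=
  LinearMap.toContinuousLinearMap (LinearMap.mulRight ℝ (star (e 0 : Cl m)) ∘ₗ
    LinearMap.mulLeft ℝ (e 0 : Cl m) ∘ₗ (CliffordAlgebra.involute (Q := quadForm m)).toLinearMap)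

/-- `compA` as a continuous linear map. -/
def compACLM (m : ℕ) : Cl m →L[ℝ] Cl m := ContinuousLinearMap.id ℝ _ + reflectCLM m

theorem compACLM_apply (c : Cl m) : compACLM m c = compA c := rfl

/-- `compB` as a continuous linear map. -/
def compBCLM (m : ℕ) : Cl m →L[ℝ] Cl m :=
  mulLeftCLM (e 0) ∘L (ContinuousLinearMap.id ℝ _ - reflectCLM m)

theorem compBCLM_apply (c : Cl m) : compBCLM m c = compB c := rfl

theorem star_e_zero_mul_e_succ (j : Fin m) :
    star (e 0 : Cl m) * e j.succ = -(e j.succ * star (e 0)) := by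
  rw [star_e, neg_mul, mul_neg, e_anticomm (Fin.succ_ne_zero j).symm]

theorem star_e_zero_mul_self : star (e 0 : Cl m) * star (e 0) = -1 := by
  rw [star_e, neg_mul_neg, e_sq]

theorem star_e_zero_mul_e_zero : star (e 0 : Cl m) * e 0 = 1 := by
  rw [star_e, neg_mul, e_sq, neg_neg]

/-- As `\bar{e_0}` anticommutes with `e_j` and squares to `-1`, one has `\bar{e_0} e_j (½ a + ½
\bar{e_0} b) = ½ e_j b + ½ \bar{e_0} e_j a`. This swap is the source of the alternation between `δ`
and `H`. -/
theorem comp_star_e_zero_mul_e_mul (j : Fin m) (c : Cl m) :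
    compA (star (e 0) * (e j.succ * c)) = e j.succ * compB c ∧
      compB (star (e 0) * (e j.succ * c)) = e j.succ * compA c := by
  obtain ⟨ha, hb, hc⟩ := (components_iff c _ _).2 ⟨rfl, rfl⟩
  have hj : (e j.succ : Cl m) ∈ subCl m := Algebra.subset_adjoin ⟨j, rfl⟩
  have h1 : star (e 0 : Cl m) * (e j.succ * (star (e 0) * compB c)) = e j.succ * compB c := by
    rw [← mul_assoc, star_e_zero_mul_e_succ, neg_mul, mul_assoc, ← mul_assoc (star (e 0)),
      star_e_zero_mul_self]
    simp
  have := (components_iff (star (e 0) * (e j.succ * c)) (e j.succ * compB c)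
    (e j.succ * compA c)).1 ⟨mul_mem hj hb, mul_mem hj ha, by
      conv_lhs => rw [hc]
      rw [mul_add, mul_add, mul_smul_comm, mul_smul_comm, mul_smul_comm, mul_smul_comm, h1,
        add_comm]⟩
  exact ⟨this.1.symm, this.2.symm⟩

/-! ### Monogenic functions -/

/-- `F` is annihilated by `∂_{x_0} + \bar{e_0} \underline{∂}` away from the origin. -/
def IsMonogenic (F : EuclideanSpace ℝ (Fin (m + 1)) → Cl m) : Prop :=
  ∀ x ≠ 0, fderiv ℝ F x (EuclideanSpace.single 0 1) + star (e 0) *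
    ∑ j : Fin m, e j.succ * fderiv ℝ F x (EuclideanSpace.single j.succ 1) = 0

theorem conjCR_eq {d : ℕ} {F : EuclideanSpace ℝ (Fin (m + 1)) → Cl m} (hF : HomogSmooth d F)
    {x : EuclideanSpace ℝ (Fin (m + 1))} (hx : x ≠ 0) :
    conjCR F x = (1 / 2 : ℝ) • (fderiv ℝ F x (EuclideanSpace.single 0 1) - star (e 0) *
      ∑ j : Fin m, e j.succ * fderiv ℝ F x (EuclideanSpace.single j.succ 1)) := by
  simp only [conjCR, partialDeriv, (hF.differentiableAt hx).lineDeriv_eq_fderiv]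

/-- Monogenicity turns `-\bar{e_0} \underline{∂} F` into `∂_{x_0} F`, so the two halves of `\bar D`
coincide. -/
theorem IsMonogenic.conjCR_eq_partial {d : ℕ} {F : EuclideanSpace ℝ (Fin (m + 1)) → Cl m}
    (hF : HomogSmooth d F) (hM : IsMonogenic F) {x : EuclideanSpace ℝ (Fin (m + 1))} (hx : x ≠ 0) :
    conjCR F x = fderiv ℝ F x (EuclideanSpace.single 0 1) := by
  rw [conjCR_eq hF hx, eq_neg_of_add_eq_zero_right (hM x hx), sub_neg_eq_add, ← two_smul ℝ, smul_smul]
  norm_num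

theorem IsMonogenic.conjCR_eq_dirac {d : ℕ} {F : EuclideanSpace ℝ (Fin (m + 1)) → Cl m}
    (hF : HomogSmooth d F) (hM : IsMonogenic F) {x : EuclideanSpace ℝ (Fin (m + 1))} (hx : x ≠ 0) :
    conjCR F x = -∑ j : Fin m,
      star (e 0) * (e j.succ * fderiv ℝ F x (EuclideanSpace.single j.succ 1)) := by
  rw [hM.conjCR_eq_partial hF hx, eq_neg_of_add_eq_zero_left (hM x hx), Finset.mul_sum]

/-- Here `\bar D F = ∂_{x_0} F`, and `∂_{x_0}` commutes with the constant-coefficient operator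
`∂_{x_0} + \bar{e_0} \underline{∂}` by symmetry of the second derivative. -/
theorem IsMonogenic.conjCR {d : ℕ} {F : EuclideanSpace ℝ (Fin (m + 1)) → Cl m}
    (hF : HomogSmooth d F) (hM : IsMonogenic F) :
    HomogSmooth (d + 1) (conjCR F) ∧ IsMonogenic (Downstream.conjCR F) := by
  refine ⟨(hF.fderiv_apply (EuclideanSpace.single 0 1)).congr
    fun x hx => hM.conjCR_eq_partial hF hx, fun x hx => ?_⟩
  have hev : Downstream.conjCR F =ᶠ[𝓝 x] fun y => fderiv ℝ F y (EuclideanSpace.single 0 1) := by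
    filter_upwards [isOpen_compl_singleton.mem_nhds hx] with y hy using hM.conjCR_eq_partial hF hy
  have hdd : DifferentiableAt ℝ (fderiv ℝ F) x :=
    ((hF.contDiffAt hx).fderiv_right (m := ∞) (by simp)).differentiableAt (by simp)
  have hap : ∀ v, HasFDerivAt (fun y => fderiv ℝ F y v)
      ((ContinuousLinearMap.apply ℝ (Cl m) v).comp (fderiv ℝ (fderiv ℝ F) x)) x := fun v =>
    (ContinuousLinearMap.apply ℝ (Cl m) v).hasFDerivAt.comp x hdd.hasFDerivAt
  have hsymm := (hF.contDiffAt hx).isSymmSndFDerivAt (by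
    rw [minSmoothness_of_isRCLikeNormedField]
    exact WithTop.coe_le_coe.2 le_top)
  have hv : ∀ v, fderiv ℝ (Downstream.conjCR F) x v
      = fderiv ℝ (fderiv ℝ F) x (EuclideanSpace.single 0 1) v := by
    intro v
    rw [hev.fderiv_eq, (hap _).fderiv]
    exact hsymm.eq _ _
  have hzero : (fun y => fderiv ℝ F y (EuclideanSpace.single 0 1) + mulLeftCLM (star (e 0))
      (∑ j : Fin m, mulLeftCLM (e j.succ) (fderiv ℝ F y (EuclideanSpace.single j.succ 1))))
      =ᶠ[𝓝 x] fun _ => (0 : Cl m) := by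
    filter_upwards [isOpen_compl_singleton.mem_nhds hx] with y hy using hM y hy
  have hsum := (hap (EuclideanSpace.single 0 1)).add
    ((mulLeftCLM (star (e 0 : Cl m))).hasFDerivAt.comp x (HasFDerivAt.fun_sum
      (u := Finset.univ) fun (j : Fin m) _ => (mulLeftCLM (e j.succ : Cl m)).hasFDerivAt.comp x
        (hap (EuclideanSpace.single j.succ 1))))
  have h0 := hsum.unique ((hasFDerivAt_const (0 : Cl m) x).congr_of_eventuallyEq hzero)
  -- The monogenicity equation, differentiated in the direction `e_0`.
  have h1 := congrArg (fun L => L (EuclideanSpace.single 0 (1 : ℝ))) h0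
  simp only [hv]
  simpa [mulLeftCLM_apply, Finset.mul_sum] using h1

/-! ### The Cauchy kernel -/

/-- The embedding `x ↦ ∑_{α=0}^m x_α e_α` of `ℝ^{m+1}` into the Clifford algebra. -/
def vec' (m : ℕ) : EuclideanSpace ℝ (Fin (m + 1)) →L[ℝ] Cl m :=
  LinearMap.toContinuousLinearMap (CliffordAlgebra.ι (quadForm m) ∘ₗ
    (WithLp.linearEquiv 2 ℝ (Fin (m + 1) → ℝ)).toLinearMap)

theorem vec'_apply (x : EuclideanSpace ℝ (Fin (m + 1))) :
    vec' m x = CliffordAlgebra.ι (quadForm m) x.ofLp := rfl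

theorem vec'_single (α : Fin (m + 1)) : vec' m (EuclideanSpace.single α 1) = e α := rfl

theorem vec'_eq_sum (x : EuclideanSpace ℝ (Fin (m + 1))) : vec' m x = ∑ α, x α • e α := by
  rw [vec'_apply]
  conv_lhs => rw [pi_eq_sum_univ' x.ofLp]
  simp [e, map_sum]

theorem vec_apply (x : EuclideanSpace ℝ (Fin m)) : vec m x = ∑ j, x j • e j.succ := by
  simp [vec]

theorem vec'_point (x₀ : ℝ) (x : EuclideanSpace ℝ (Fin m)) :
    vec' m (point x₀ x) = x₀ • e 0 + vec m x := by
  rw [vec'_eq_sum, Fin.sum_univ_succ, vec_apply]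
  simp [point]

theorem vec'_mul_self (x : EuclideanSpace ℝ (Fin (m + 1))) :
    vec' m x * vec' m x = (-‖x‖ ^ 2) • (1 : Cl m) := by
  rw [vec'_apply, CliffordAlgebra.ι_sq_scalar, Algebra.algebraMap_eq_smul_one]
  congr 1
  rw [EuclideanSpace.norm_sq_eq]
  simp [quadForm, QuadraticMap.weightedSumSquares_apply, sq]

theorem vec_mem_subCl (x : EuclideanSpace ℝ (Fin m)) : vec m x ∈ subCl m := by
  rw [vec_apply]
  exact sum_mem fun j _ => (subCl m).smul_mem (Algebra.subset_adjoin ⟨j, rfl⟩) _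

/-- The linear map `x ↦ x \bar{e_0}`. -/
def vecMulStar (m : ℕ) : EuclideanSpace ℝ (Fin (m + 1)) →L[ℝ] Cl m :=
  (LinearMap.toContinuousLinearMap (LinearMap.mulRight ℝ (star (e 0 : Cl m)))).comp (vec' m)

theorem vecMulStar_apply (x : EuclideanSpace ℝ (Fin (m + 1))) :
    vecMulStar m x = vec' m x * star (e 0) := rfl

theorem cauchyKernel_eq (x : EuclideanSpace ℝ (Fin (m + 1))) :
    cauchyKernel m x = (1 / sphereArea (m + 1) * (‖x‖ ^ (m + 1))⁻¹) • vecMulStar m x := by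
  rw [cauchyKernel, vecMulStar_apply, vec'_apply, one_div, one_div, mul_inv]

theorem hasFDerivAt_inv_norm_pow (n : ℕ) {x : EuclideanSpace ℝ (Fin (m + 1))} (hx : x ≠ 0) :
    HasFDerivAt (fun y : EuclideanSpace ℝ (Fin (m + 1)) => (‖y‖ ^ n)⁻¹)
      (-(n * (‖x‖ ^ (n + 2))⁻¹) • innerSL ℝ x) x := by
  have hn : ‖x‖ ≠ 0 := norm_ne_zero_iff.2 hx
  have h1 : HasFDerivAt (fun y : EuclideanSpace ℝ (Fin (m + 1)) => ‖y‖) (‖x‖⁻¹ • innerSL ℝ x) x := by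
    have := (hasStrictFDerivAt_norm_sq x).hasFDerivAt.sqrt (pow_ne_zero 2 hn)
    simp only [Real.sqrt_sq (norm_nonneg _)] at this
    refine this.congr_fderiv ?_
    ext v
    simp
    field_simp
  have h2 := (hasDerivAt_inv (pow_ne_zero n hn)).comp_hasFDerivAt x (h1.pow n)
  refine h2.congr_fderiv ?_
  ext v
  simp only [smul_apply, smul_eq_mul, nsmul_eq_mul]
  -- The power rule contains the truncated exponent `n - 1`, so `n = 0` is separate.
  rcases n with _ | n
  · simp
  · simp only [Nat.add_sub_cancel]
    field_simp
    ring

theorem cauchyKernel_homogSmooth (m : ℕ) : HomogSmooth m (cauchyKernel m) where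
  smooth := by
    have : ContDiffOn ℝ ∞ (fun x : EuclideanSpace ℝ (Fin (m + 1)) =>
        (1 / sphereArea (m + 1) * (‖x‖ ^ (m + 1))⁻¹) • vecMulStar m x) {0}ᶜ := by
      suffices h : ContDiffOn ℝ ∞ (fun x : EuclideanSpace ℝ (Fin (m + 1)) =>
          1 / sphereArea (m + 1) * (‖x‖ ^ (m + 1))⁻¹) {0}ᶜ from
        h.smul (vecMulStar m).contDiff.contDiffOn
      refine contDiffOn_const.mul (ContDiffOn.inv (ContDiffOn.pow ?_ _) fun x hx => ?_)
      · exact fun x hx => ContDiffAt.contDiffWithinAt (f := fun x => ‖x‖) (contDiffAt_norm ℝ hx)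
      · exact pow_ne_zero _ (norm_ne_zero_iff.2 hx)
    exact this.congr fun x _ => cauchyKernel_eq x
  homog t ht x hx := by
    have hn : ‖x‖ ≠ 0 := norm_ne_zero_iff.2 hx
    rw [cauchyKernel_eq, cauchyKernel_eq, map_smul, norm_smul, Real.norm_of_nonneg ht.le,
      smul_smul, smul_smul]
    congr 1
    field_simp
    ring

/-- In `∑ e_α ∂_α (x |x|^{-m-1})` the terms `e_α e_α` contribute `-(m+1) |x|^{-m-1}`, and the
gradient of the weight contributes `-(m+1) |x|^{-m-3} x x = (m+1) |x|^{-m-1}`. The sum is zero, and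
multiplying on the left by `\bar{e_0}`, with `\bar{e_0} e_0 = 1`, gives the operator in
`IsMonogenic`. -/
theorem cauchyKernel_isMonogenic (m : ℕ) : IsMonogenic (cauchyKernel m) := by
  intro x hx
  have hn : ‖x‖ ≠ 0 := norm_ne_zero_iff.2 hx
  have hd := (((hasFDerivAt_inv_norm_pow (m + 1) hx).const_mul (1 / sphereArea (m + 1))).smul
    ((vecMulStar m).hasFDerivAt (x := x))).congr_of_eventuallyEq (f₁ := cauchyKernel m)
    (Eventually.of_forall fun y => cauchyKernel_eq y)
  have hα : ∀ α : Fin (m + 1), e α * fderiv ℝ (cauchyKernel m) x (EuclideanSpace.single α 1)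
      = (1 / sphereArea (m + 1)) • (((‖x‖ ^ (m + 1))⁻¹ • (e α * e α)
        - ((m + 1 : ℕ) * (‖x‖ ^ (m + 1 + 2))⁻¹) • ((x α • e α) * vec' m x)) * star (e 0)) := by
    intro α
    rw [hd.fderiv]
    simp only [_root_.add_apply, smul_apply, ContinuousLinearMap.smulRight_apply,
      vecMulStar_apply, vec'_single, innerSL_apply_apply, EuclideanSpace.inner_single_right, smul_eq_mul]
    simp only [mul_add, mul_smul_comm, sub_mul, smul_sub, smul_mul_assoc, smul_smul, ← mul_assoc]
    rw [sub_eq_add_neg, ← neg_smul]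
    congr 2
    rw [RCLike.conj_to_real]
    ring
  have hsum : ∑ α : Fin (m + 1), e α * fderiv ℝ (cauchyKernel m) x (EuclideanSpace.single α 1)
      = 0 := by
    simp_rw [hα]
    rw [← Finset.smul_sum, ← Finset.sum_mul, Finset.sum_sub_distrib, ← Finset.smul_sum,
      ← Finset.smul_sum, ← Finset.sum_mul, ← vec'_eq_sum, vec'_mul_self]
    simp only [e_sq, Finset.sum_const, Finset.card_univ, Fintype.card_fin, smul_smul]
    have : (‖x‖ ^ (m + 1))⁻¹ • ((m + 1) • (-1 : Cl m))
        - ((m + 1 : ℕ) * (‖x‖ ^ (m + 1 + 2))⁻¹ * -‖x‖ ^ 2) • (1 : Cl m) = 0 := by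
      rw [← Nat.cast_smul_eq_nsmul ℝ, smul_neg, smul_neg, smul_smul, ← neg_smul, ← sub_smul]
      have : -((‖x‖ ^ (m + 1))⁻¹ * ((m + 1 : ℕ) : ℝ))
          - (m + 1 : ℕ) * (‖x‖ ^ (m + 1 + 2))⁻¹ * -‖x‖ ^ 2 = 0 := by
        rw [pow_add ‖x‖ (m + 1) 2]
        field_simp
        ring
      rw [this, zero_smul]
    rw [this]
    simp
  rw [Fin.sum_univ_succ] at hsum
  have := congrArg (fun c => star (e 0) * c) hsum
  simpa [mul_add, ← mul_assoc, star_e_zero_mul_e_zero] using this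

/-! ### The downstream potentials -/

theorem potC_succ (m k : ℕ) : potC m (k + 1) = conjCR (potC m k) :=
  Function.iterate_succ_apply' _ _ _

theorem potC_homogSmooth_isMonogenic (m k : ℕ) :
    HomogSmooth (m + k) (potC m k) ∧ IsMonogenic (potC m k) := by
  induction k with
  | zero => exact ⟨cauchyKernel_homogSmooth m, cauchyKernel_isMonogenic m⟩
  | succ k ih =>
    rw [potC_succ]
    exact ih.2.conjCR ih.1

theorem potA_homogSmooth (m k : ℕ) : HomogSmooth (m + k) (potA m k) :=
  (potC_homogSmooth_isMonogenic m k).1.clm_comp (compACLM m)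

theorem potB_homogSmooth (m k : ℕ) : HomogSmooth (m + k) (potB m k) :=
  (potC_homogSmooth_isMonogenic m k).1.clm_comp (compBCLM m)

theorem fderiv_potA {k : ℕ} {x : EuclideanSpace ℝ (Fin (m + 1))} (hx : x ≠ 0)
    (v : EuclideanSpace ℝ (Fin (m + 1))) :
    fderiv ℝ (potA m k) x v = compA (fderiv ℝ (potC m k) x v) := by
  have := (compACLM m).hasFDerivAt.comp x
    ((potC_homogSmooth_isMonogenic m k).1.differentiableAt hx).hasFDerivAt
  exact congrArg (fun L => L v) this.fderiv

theorem fderiv_potB {k : ℕ} {x : EuclideanSpace ℝ (Fin (m + 1))} (hx : x ≠ 0)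
    (v : EuclideanSpace ℝ (Fin (m + 1))) :
    fderiv ℝ (potB m k) x v = compB (fderiv ℝ (potC m k) x v) := by
  have := (compBCLM m).hasFDerivAt.comp x
    ((potC_homogSmooth_isMonogenic m k).1.differentiableAt hx).hasFDerivAt
  exact congrArg (fun L => L v) this.fderiv

/-- On the monogenic `C_{-k-1}` the operator `\bar D` is `-\bar{e_0} \underline{∂}`, which exchanges
the components. -/
theorem potA_succ (k : ℕ) {x : EuclideanSpace ℝ (Fin (m + 1))} (hx : x ≠ 0) :
    potA m (k + 1) x
      = -∑ j : Fin m, e j.succ * fderiv ℝ (potB m k) x (EuclideanSpace.single j.succ 1) := by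
  obtain ⟨h1, h2⟩ := potC_homogSmooth_isMonogenic m k
  rw [potA, potC_succ, h2.conjCR_eq_dirac h1 hx, ← compACLM_apply, map_neg, map_sum]
  simp_rw [compACLM_apply, (comp_star_e_zero_mul_e_mul _ _).1, fderiv_potB hx]

theorem potB_succ (k : ℕ) {x : EuclideanSpace ℝ (Fin (m + 1))} (hx : x ≠ 0) :
    potB m (k + 1) x
      = -∑ j : Fin m, e j.succ * fderiv ℝ (potA m k) x (EuclideanSpace.single j.succ 1) := by
  obtain ⟨h1, h2⟩ := potC_homogSmooth_isMonogenic m k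
  rw [potB, potC_succ, h2.conjCR_eq_dirac h1 hx, ← compBCLM_apply, map_neg, map_sum]
  simp_rw [compBCLM_apply, (comp_star_e_zero_mul_e_mul _ _).2, fderiv_potA hx]

/-- From `x \bar{e_0} = x_0 - \bar{e_0} \underline{x}`. Up to constants the components are the
Poisson kernel and its conjugate. -/
theorem pot_zero_point (x₀ : ℝ) (x : EuclideanSpace ℝ (Fin m)) :
    potA m 0 (point x₀ x)
      = (2 / sphereArea (m + 1) * (x₀ * (‖point x₀ x‖ ^ (m + 1))⁻¹)) • (1 : Cl m) ∧
    potB m 0 (point x₀ x)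
      = (-(2 / sphereArea (m + 1)) * (‖point x₀ x‖ ^ (m + 1))⁻¹) • vec m x := by
  have hv : vec m x * star (e 0) = -(star (e 0) * vec m x) := by
    rw [vec_apply, Finset.sum_mul, Finset.mul_sum, ← Finset.sum_neg_distrib]
    refine Finset.sum_congr rfl fun j _ => ?_
    rw [smul_mul_assoc, mul_smul_comm, star_e_zero_mul_e_succ, smul_neg, neg_neg]
  have h0 : (e 0 : Cl m) * star (e 0) = 1 := by rw [star_e, mul_neg, e_sq, neg_neg]
  have := (components_iff (potC m 0 (point x₀ x))
    ((2 / sphereArea (m + 1) * (x₀ * (‖point x₀ x‖ ^ (m + 1))⁻¹)) • (1 : Cl m))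
    ((-(2 / sphereArea (m + 1)) * (‖point x₀ x‖ ^ (m + 1))⁻¹) • vec m x)).1
    ⟨(subCl m).smul_mem (one_mem _) _, (subCl m).smul_mem (vec_mem_subCl x) _, by
      change cauchyKernel m _ = _
      rw [cauchyKernel_eq, vecMulStar_apply, vec'_point, add_mul, smul_mul_assoc, h0, hv, mul_smul_comm, smul_smul,
        smul_smul, smul_add, smul_smul, smul_neg, ← neg_smul]
      congr 2 <;> ring⟩
  exact ⟨this.1.symm, this.2.symm⟩

/-! ### Boundary values of the downstream potentials -/

/-- Each step applies `-\underline{∂}` and swaps the components; two steps restore them and cancel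
the signs, so the induction runs over pairs. -/
theorem isBoundaryValue_pot {l : Filter ℝ} (hl : ∀ᶠ x₀ in l, x₀ ≠ 0) {S T : CliffordDistrib m}
    (hA : IsBoundaryValue l (potA m 0) S) (hB : IsBoundaryValue l (potB m 0) T) (i : ℕ) :
    (IsBoundaryValue l (potA m (2 * i)) (dirac^[2 * i] S) ∧
      IsBoundaryValue l (potB m (2 * i)) (dirac^[2 * i] T)) ∧
    (IsBoundaryValue l (potA m (2 * i + 1)) (-dirac^[2 * i + 1] T) ∧
      IsBoundaryValue l (potB m (2 * i + 1)) (-dirac^[2 * i + 1] S)) := by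
  have odd : ∀ i, IsBoundaryValue l (potA m (2 * i)) (dirac^[2 * i] S) ∧
      IsBoundaryValue l (potB m (2 * i)) (dirac^[2 * i] T) →
      IsBoundaryValue l (potA m (2 * i + 1)) (-dirac^[2 * i + 1] T) ∧
      IsBoundaryValue l (potB m (2 * i + 1)) (-dirac^[2 * i + 1] S) := fun i h => by
    rw [Function.iterate_succ_apply', Function.iterate_succ_apply']
    exact ⟨h.2.dirac hl (potB_homogSmooth m _) fun x hx => potA_succ _ hx,
      h.1.dirac hl (potA_homogSmooth m _) fun x hx => potB_succ _ hx⟩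
  have even : ∀ i, IsBoundaryValue l (potA m (2 * i)) (dirac^[2 * i] S) ∧
      IsBoundaryValue l (potB m (2 * i)) (dirac^[2 * i] T) := fun i => by
    induction i with
    | zero => exact ⟨hA, hB⟩
    | succ i ih =>
      have h := odd i ih
      have hA' := h.2.dirac hl (potB_homogSmooth m _) fun x hx => potA_succ _ hx
      have hB' := h.1.dirac hl (potA_homogSmooth m _) fun x hx => potB_succ _ hx
      rw [dirac_neg, neg_neg, ← Function.iterate_succ_apply' dirac] at hA' hB'
      exact ⟨hA', hB'⟩
  exact ⟨even i, odd i (even i)⟩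

end

section

variable {m : ℕ}

/-! ### The total mass of the Poisson kernel -/

/-- The Poisson kernel at height `1`, up to normalization. -/
def poisson (m : ℕ) (y : EuclideanSpace ℝ (Fin m)) : ℝ := (‖point 1 y‖ ^ (m + 1))⁻¹

theorem poisson_eq_rpow (y : EuclideanSpace ℝ (Fin m)) :
    poisson m y = (1 + ‖y‖ ^ 2) ^ (-((m : ℝ) + 1) / 2) := by
  have h : ‖point 1 y‖ = (1 + ‖y‖ ^ 2) ^ (1 / 2 : ℝ) := by
    rw [← Real.sqrt_eq_rpow, eq_comm, Real.sqrt_eq_iff_mul_self_eq (by positivity) (norm_nonneg _),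
      ← sq, norm_point_sq, one_pow]
  rw [poisson, h, ← Real.rpow_natCast, ← Real.rpow_mul (by positivity),
    ← Real.rpow_neg (by positivity)]
  congr 1
  push_cast
  ring

theorem poisson_nonneg (y : EuclideanSpace ℝ (Fin m)) : 0 ≤ poisson m y := by
  unfold poisson; positivity

theorem integrable_poisson (m : ℕ) : Integrable (poisson m) := by
  have := integrable_rpow_neg_one_add_norm_sq (E := EuclideanSpace ℝ (Fin m)) (μ := volume)
    (r := (m : ℝ) + 1) (by simp)
  exact this.congr (Eventually.of_forall fun y => (poisson_eq_rpow y).symm)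

theorem sphereArea_pos {n : ℕ} (hn : 0 < n) : 0 < sphereArea n := by
  have : (0 : ℝ) < n := Nat.cast_pos.2 hn
  have := Real.Gamma_pos_of_pos (half_pos this)
  have := Real.pi_pos
  unfold sphereArea
  positivity

/-- With `a = (m+1)/2`, write `Γ(a) (1+|y|²)^{-a} = ∫_0^∞ t^{a-1} e^{-(1+|y|²)t} dt` and exchange
the integrals. The Gaussian integral over `y` is `(π/t)^{m/2}`, which leaves `π^{m/2} Γ(1/2) =
π^{(m+1)/2}`. -/
theorem integral_poisson (m : ℕ) : ∫ y, poisson m y = sphereArea (m + 1) / 2 := by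
  set a : ℝ := ((m : ℝ) + 1) / 2 with ha
  have ha0 : 0 < a := by positivity
  have hΓ := Real.Gamma_pos_of_pos ha0
  set K : EuclideanSpace ℝ (Fin m) → ℝ → ℝ := fun y t => t ^ (a - 1) * Real.exp (-((1 + ‖y‖ ^ 2) * t))
    with hK
  have h1 : ∀ y : EuclideanSpace ℝ (Fin m), ∫ t in Ioi 0, K y t = poisson m y * Real.Gamma a := by
    intro y
    rw [hK, Real.integral_rpow_mul_exp_neg_mul_Ioi ha0 (by positivity), poisson_eq_rpow, one_div,
      Real.inv_rpow (by positivity), ← Real.rpow_neg (by positivity), ha, neg_div]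
  have hsplit : ∀ (y : EuclideanSpace ℝ (Fin m)) (t : ℝ),
      K y t = t ^ (a - 1) * Real.exp (-t) * Real.exp (-t * ‖y‖ ^ 2) := by
    intro y t
    rw [hK, mul_assoc, ← Real.exp_add]
    ring_nf
  have h2 : ∀ t ∈ Ioi (0 : ℝ), ∫ y : EuclideanSpace ℝ (Fin m), K y t
      = Real.pi ^ ((m : ℝ) / 2) * (Real.exp (-t) * t ^ ((1 / 2 : ℝ) - 1)) := by
    intro t ht
    have ht' : (0 : ℝ) < t := ht
    simp_rw [hsplit]
    rw [integral_const_mul, GaussianFourier.integral_rexp_neg_mul_sq_norm ht',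
      finrank_euclideanSpace_fin, Real.div_rpow Real.pi_pos.le ht'.le]
    have : t ^ ((1 / 2 : ℝ) - 1) = t ^ (a - 1) / t ^ ((m : ℝ) / 2) := by
      rw [← Real.rpow_sub ht', ha]; congr 1; ring
    rw [this]
    ring
  have hmeas : AEStronglyMeasurable (Function.uncurry fun t y => K y t)
      ((volume.restrict (Ioi 0)).prod (volume : Measure (EuclideanSpace ℝ (Fin m)))) := by
    simp only [hK]
    exact Measurable.aestronglyMeasurable (by fun_prop)
  have hint : Integrable (Function.uncurry fun t y => K y t)
      ((volume.restrict (Ioi 0)).prod (volume : Measure (EuclideanSpace ℝ (Fin m)))) := by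
    rw [integrable_prod_iff hmeas]
    constructor
    · refine (ae_restrict_iff' measurableSet_Ioi).2 (Eventually.of_forall fun t ht => ?_)
      have ht' : (0 : ℝ) < t := ht
      -- A non-integrable function has Bochner integral `0`, while the value found in `h2` is
      -- positive.
      refine Integrable.of_integral_ne_zero ?_
      change ∫ y, K y t ≠ 0
      rw [h2 t ht]
      have := Real.pi_pos
      positivity
    · refine ((Real.GammaIntegral_convergent (s := 1 / 2) (by norm_num)).const_mul
        (Real.pi ^ ((m : ℝ) / 2))).congr
        ((ae_restrict_iff' measurableSet_Ioi).2 (Eventually.of_forall fun t ht => ?_))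
      have ht' : (0 : ℝ) < t := ht
      dsimp only
      rw [← h2 t ht]
      refine integral_congr_ae (Eventually.of_forall fun y => ?_)
      change K y t = ‖K y t‖
      rw [Real.norm_of_nonneg]
      simp only [hK]
      positivity
  have hswap := integral_integral_swap hint
  have h3 : ∫ t in Ioi (0 : ℝ), ∫ y : EuclideanSpace ℝ (Fin m), K y t
      = Real.pi ^ ((m : ℝ) / 2) * Real.Gamma (1 / 2) := by
    rw [setIntegral_congr_fun measurableSet_Ioi h2, integral_const_mul,
      Real.Gamma_eq_integral (by norm_num)]
  rw [h3] at hswap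
  simp_rw [h1] at hswap
  rw [integral_mul_const, Real.Gamma_one_half_eq, Real.sqrt_eq_rpow,
    ← Real.rpow_add Real.pi_pos] at hswap
  have ha' : (((m + 1 : ℕ) : ℝ)) / 2 = a := by push_cast; rw [ha]
  rw [sphereArea, ha', eq_comm, div_div, div_eq_iff (by positivity)]
  have : Real.pi ^ a = Real.pi ^ ((m : ℝ) / 2 + 1 / 2) := by rw [ha]; congr 1; ring
  rw [this, hswap]
  ring

/-! ### Boundary values of the conjugate harmonic pair `A_{-1}, B_{-1}` -/

theorem tendsto_integral_comp_smul_mul_poisson (φ : 𝓢(EuclideanSpace ℝ (Fin m), ℝ)) :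
    Tendsto (fun t : ℝ => ∫ y, φ (t • y) * poisson m y) (𝓝 0)
      (𝓝 (sphereArea (m + 1) / 2 * φ 0)) := by
  have h0 : sphereArea (m + 1) / 2 * φ 0 = ∫ y, φ ((0 : ℝ) • y) * poisson m y := by
    simp_rw [zero_smul]
    rw [integral_const_mul, integral_poisson, mul_comm]
  rw [h0]
  refine tendsto_integral_filter_of_dominated_convergence
    (fun y => SchwartzMap.seminorm ℝ 0 0 φ * poisson m y) ?_ ?_
    ((integrable_poisson m).const_mul _) ?_
  · refine Eventually.of_forall fun t => ?_
    exact (φ.continuous.comp (continuous_const_smul t)).aestronglyMeasurable.mul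
      (integrable_poisson m).aestronglyMeasurable
  · refine Eventually.of_forall fun t => Eventually.of_forall fun y => ?_
    rw [norm_mul, Real.norm_of_nonneg (poisson_nonneg y)]
    exact mul_le_mul_of_nonneg_right (SchwartzMap.norm_le_seminorm ℝ φ _) (poisson_nonneg y)
  · refine Eventually.of_forall fun y => ?_
    refine Tendsto.mul_const _ ?_
    exact (φ.continuous.comp (continuous_id.smul continuous_const)).tendsto _

theorem norm_point (t : ℝ) (x : EuclideanSpace ℝ (Fin m)) :
    ‖point t x‖ = √(t ^ 2 + ‖x‖ ^ 2) := by
  rw [← norm_point_sq, Real.sqrt_sq (norm_nonneg _)]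

theorem norm_point_smul (t : ℝ) (y : EuclideanSpace ℝ (Fin m)) :
    ‖point t (t • y)‖ = |t| * ‖point 1 y‖ := by
  refine (sq_eq_sq₀ (norm_nonneg _) (by positivity)).1 ?_
  rw [mul_pow, norm_point_sq, norm_point_sq, norm_smul, mul_pow, sq_abs, Real.norm_eq_abs, sq_abs]
  ring

/-- The substitution `x = t y` has Jacobian `|t|^m`, whereas the kernel scales like `t |t|^{-m-1}`.
The leftover sign `t/|t|` is the jump of `A_{-1}` across the hyperplane. -/
theorem integral_smul_potA_zero (φ : 𝓢(EuclideanSpace ℝ (Fin m), ℝ)) {t : ℝ} (ht : t ≠ 0) :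
    ∫ x, φ x • potA m 0 (point t x)
      = (t / |t| * (2 / sphereArea (m + 1) * ∫ y, φ (t • y) * poisson m y)) • (1 : Cl m) := by
  have h := Measure.integral_comp_smul (volume : Measure (EuclideanSpace ℝ (Fin m)))
    (fun x => φ x * (t * (‖point t x‖ ^ (m + 1))⁻¹)) t
  have ht' : 0 < |t| := abs_pos.2 ht
  have h1 : ∀ y : EuclideanSpace ℝ (Fin m), φ (t • y) * (t * (‖point t (t • y)‖ ^ (m + 1))⁻¹)
      = t / |t| * (|t| ^ m)⁻¹ * (φ (t • y) * poisson m y) := by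
    intro y
    rw [norm_point_smul, mul_pow, mul_inv, poisson, pow_succ |t| m, mul_inv]
    ring
  simp_rw [h1] at h
  rw [integral_const_mul, finrank_euclideanSpace_fin, abs_inv, abs_pow, smul_eq_mul,
    mul_comm (t / |t|), mul_assoc] at h
  have h2 := mul_left_cancel₀ (inv_ne_zero (pow_ne_zero m ht'.ne')) h
  simp_rw [fun x => (pot_zero_point t x).1, smul_smul]
  rw [integral_smul_const, mul_left_comm, h2, ← integral_const_mul]
  congr 1
  refine integral_congr_ae (Eventually.of_forall fun x => ?_)
  dsimp only
  ring

theorem isBoundaryValue_potA_zero (m : ℕ) :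
    IsBoundaryValue (𝓝[>] 0) (potA m 0) (delta m) ∧
      IsBoundaryValue (𝓝[<] 0) (potA m 0) (-delta m) := by
  have hσ := sphereArea_pos (Nat.succ_pos m)
  -- Both sides at once, `s` being the sign of `x_0` along `l`.
  have key : ∀ (l : Filter ℝ) (s : ℝ), l ≤ 𝓝 0 → (∀ᶠ t in l, t ≠ 0 ∧ t / |t| = s) →
      IsBoundaryValue l (potA m 0) (s • delta m) := by
    intro l s hl hs φ
    refine ⟨hs.mono fun t ht => (potA_homogSmooth m 0).integrable_smul ht.1 φ, ?_⟩
    have h := (((tendsto_integral_comp_smul_mul_poisson φ).mono_left hl).const_mul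
      (s * (2 / sphereArea (m + 1)))).smul_const (1 : Cl m)
    have hval : (s • delta m) φ
        = (s * (2 / sphereArea (m + 1)) * (sphereArea (m + 1) / 2 * φ 0)) • (1 : Cl m) := by
      rw [_root_.smul_apply, delta_apply, smul_smul]
      congr 1
      field_simp
    rw [hval]
    refine h.congr' (hs.mono fun t ht => ?_)
    dsimp only
    rw [integral_smul_potA_zero φ ht.1, ht.2, mul_assoc]
  refine ⟨?_, ?_⟩
  · have := key (𝓝[>] 0) 1 nhdsWithin_le_nhds (by
      filter_upwards [self_mem_nhdsWithin] with t ht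
      have ht' : (0 : ℝ) < t := ht
      exact ⟨ht'.ne', by rw [abs_of_pos ht', div_self ht'.ne']⟩)
    rwa [one_smul] at this
  · have := key (𝓝[<] 0) (-1) nhdsWithin_le_nhds (by
      filter_upwards [self_mem_nhdsWithin] with t ht
      have ht' : t < 0 := ht
      exact ⟨ht'.ne, by rw [abs_of_neg ht', div_neg, div_self ht'.ne]⟩)
    rwa [neg_one_smul] at this

/-! ### The conjugate Poisson kernel and the principal value -/

theorem integrable_conjugate_poisson (φ : 𝓢(EuclideanSpace ℝ (Fin m), ℝ)) {t : ℝ} (ht : t ≠ 0) :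
    Integrable fun x : EuclideanSpace ℝ (Fin m) =>
      (φ x * (‖point t x‖ ^ (m + 1))⁻¹) • x := by
  have ht' : 0 < |t| := abs_pos.2 ht
  refine ((φ.integrable_pow_mul volume 1).mul_const (|t| ^ (m + 1))⁻¹).mono' ?_
    (Eventually.of_forall fun x => ?_)
  · refine Measurable.aestronglyMeasurable ?_
    have := (continuous_point (m := m) t).norm.measurable
    have := φ.continuous.measurable
    fun_prop
  · rw [norm_smul, norm_mul, norm_inv, norm_pow, norm_norm, pow_one, mul_comm ‖x‖, mul_right_comm]
    gcongr
    exact abs_le_norm_point t x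

/-- The kernel is odd in `x`, so only the odd part of `φ` counts. After this symmetrization `|(t,
x)| ≥ |x|` makes the limiting integrand `pvIntegrand φ` an integrable majorant. The kernel depends
on `t` only through `t²`, hence one limit for both sides. -/
theorem tendsto_integral_conjugate_poisson (φ : 𝓢(EuclideanSpace ℝ (Fin m), ℝ)) :
    Tendsto (fun t : ℝ => ∫ x, (φ x * (‖point t x‖ ^ (m + 1))⁻¹) • x) (𝓝[≠] 0) (𝓝 (pv φ)) := by
  have hcont : ∀ t : ℝ, Continuous fun x : EuclideanSpace ℝ (Fin m) => ‖point t x‖ := fun t =>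
    (continuous_point t).norm
  have key : Tendsto (fun t : ℝ => (1 / 2 : ℝ) •
      ∫ x, ((φ x - φ (-x)) * (‖point t x‖ ^ (m + 1))⁻¹) • x) (𝓝[≠] 0)
      (𝓝 ((1 / 2 : ℝ) • ∫ x, pvIntegrand φ x)) := by
    refine Tendsto.const_smul ?_ _
    refine tendsto_integral_filter_of_dominated_convergence (fun x => ‖pvIntegrand φ x‖) ?_ ?_
      (integrable_pvIntegrand φ).norm ?_
    · refine Eventually.of_forall fun t => Measurable.aestronglyMeasurable ?_
      have := (hcont t).measurable
      have := φ.continuous.measurable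
      fun_prop
    · refine Eventually.of_forall fun t => Eventually.of_forall fun x => ?_
      rcases eq_or_ne x 0 with rfl | hx
      · simp
      have hn : 0 < ‖x‖ := norm_pos_iff.2 hx
      rw [pvIntegrand, smul_smul, norm_smul, norm_smul, div_eq_mul_inv, mul_assoc, ← mul_inv,
        ← pow_succ, norm_mul, norm_mul, norm_inv, norm_inv, norm_pow, norm_pow, norm_norm, norm_norm]
      gcongr
      exact norm_le_norm_point t x
    · refine Eventually.of_forall fun x => ?_
      rcases eq_or_ne x 0 with rfl | hx
      · simp [pvIntegrand]
      have hn : 0 < ‖x‖ := norm_pos_iff.2 hx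
      have hp : Tendsto (fun t : ℝ => ‖point t x‖) (𝓝[≠] 0) (𝓝 ‖x‖) := by
        have h0 : Continuous fun t : ℝ => ‖point t x‖ := by
          simp_rw [norm_point]
          fun_prop
        have h1 := h0.tendsto 0
        rw [norm_point 0 x, sq, zero_mul, zero_add, Real.sqrt_sq (norm_nonneg _)] at h1
        exact h1.mono_left nhdsWithin_le_nhds
      have := (((hp.pow (m + 1)).inv₀ (pow_ne_zero _ hn.ne')).const_mul (φ x - φ (-x))).smul_const x
      rw [pvIntegrand, smul_smul, div_eq_mul_inv, mul_assoc, ← mul_inv, ← pow_succ]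
      exact this
  rw [pv_eq]
  refine key.congr' ?_
  filter_upwards [self_mem_nhdsWithin] with t ht
  have hint := integrable_conjugate_poisson φ ht
  have hneg : ∀ x : EuclideanSpace ℝ (Fin m), ‖point t (-x)‖ = ‖point t x‖ := fun x => by
    refine (sq_eq_sq₀ (norm_nonneg _) (norm_nonneg _)).1 ?_
    rw [norm_point_sq, norm_point_sq, norm_neg]
  have hsum : ∫ x, ((φ x - φ (-x)) * (‖point t x‖ ^ (m + 1))⁻¹) • x
      = (∫ x, (φ x * (‖point t x‖ ^ (m + 1))⁻¹) • x)
        + ∫ x, (φ (-x) * (‖point t (-x)‖ ^ (m + 1))⁻¹) • (-x) := by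
    rw [← integral_add hint hint.comp_neg]
    refine integral_congr_ae (Eventually.of_forall fun x => ?_)
    dsimp only
    rw [hneg, smul_neg, sub_mul, sub_smul, sub_eq_add_neg]
  rw [hsum, integral_neg_eq_self (fun x : EuclideanSpace ℝ (Fin m) =>
    (φ x * (‖point t x‖ ^ (m + 1))⁻¹) • x) volume, ← two_smul ℝ, smul_smul]
  norm_num

theorem isBoundaryValue_potB_zero {l : Filter ℝ} (hl : l ≤ 𝓝[≠] 0) :
    IsBoundaryValue l (potB m 0) (hilbertKernel m) := by
  intro φ
  refine ⟨?_, ?_⟩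
  · filter_upwards [hl self_mem_nhdsWithin] with t ht
    exact (potB_homogSmooth m 0).integrable_smul ht φ
  · have h := (((vec m).continuous.tendsto _).comp
      ((tendsto_integral_conjugate_poisson φ).mono_left hl)).const_smul (-(2 / sphereArea (m + 1)))
    refine h.congr' ?_
    filter_upwards [hl self_mem_nhdsWithin] with t ht
    have h1 : ∀ x : EuclideanSpace ℝ (Fin m), φ x • potB m 0 (point t x)
        = (-(2 / sphereArea (m + 1))) • vec m ((φ x * (‖point t x‖ ^ (m + 1))⁻¹) • x) := by
      intro x
      rw [(pot_zero_point t x).2, map_smul, smul_smul, smul_smul]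
      congr 1
      ring
    simp_rw [h1]
    rw [integral_smul]
    congr 1
    exact ((vec m).integral_comp_comm (integrable_conjugate_poisson φ ht)).symm

end

/-! ### Integration over the unit sphere -/

section Sphere

variable {m : ℕ} {F : Type*} [NormedAddCommGroup F] [NormedSpace ℝ F]

local notation "Sph" => Metric.sphere (0 : EuclideanSpace ℝ (Fin m)) 1

/-- The surface measure of the unit sphere of `ℝ^m`. -/
abbrev surf (m : ℕ) : Measure (Metric.sphere (0 : EuclideanSpace ℝ (Fin m)) 1) :=
  (volume : Measure (EuclideanSpace ℝ (Fin m))).toSphere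

omit [NormedSpace ℝ F] in
theorem integrable_surf {f : Sph → F} (hf : Continuous f) : Integrable f (surf m) :=
  hf.integrable_of_hasCompactSupport (HasCompactSupport.of_compactSpace _)

open scoped Pointwise in
/-- The surface measure is invariant under linear isometries. -/
theorem integral_surf_comp_isometry
    (g : EuclideanSpace ℝ (Fin m) ≃ₗᵢ[ℝ] EuclideanSpace ℝ (Fin m))
    (f : EuclideanSpace ℝ (Fin m) → F) :
    ∫ u : Sph, f (g u) ∂surf m = ∫ u : Sph, f u ∂surf m := by
  let G : Sph ≃ₜ Sph :=
    { toFun := fun u => ⟨g u, by simp⟩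
      invFun := fun u => ⟨g.symm u, by simp⟩
      left_inv := fun u => by simp
      right_inv := fun u => by simp
      continuous_toFun := by fun_prop
      continuous_invFun := by fun_prop }
  have hG : MeasurePreserving G (surf m) (surf m) := by
    refine ⟨G.continuous.measurable, Measure.ext fun s hs => ?_⟩
    -- The surface measure of `s` is the dimension times the volume of the cone `Ioo 0 1 • s`, so
    -- invariance reduces to that of Lebesgue measure.
    rw [Measure.map_apply G.continuous.measurable hs, Measure.toSphere_apply' _ hs,
      Measure.toSphere_apply' _ (G.continuous.measurable hs)]
    congr 1
    have himg : Ioo (0 : ℝ) 1 • ((↑) '' (G ⁻¹' s) : Set (EuclideanSpace ℝ (Fin m)))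
        = g.toHomeomorph.toMeasurableEquiv ⁻¹' (Ioo (0 : ℝ) 1 • ((↑) '' s)) := by
      ext x
      simp only [Set.mem_smul, mem_image, mem_preimage]
      constructor
      · rintro ⟨r, hr, _, ⟨u, hu, rfl⟩, rfl⟩
        exact ⟨r, hr, _, ⟨G u, hu, rfl⟩, (map_smul g r _).symm⟩
      · rintro ⟨r, hr, _, ⟨u, hu, rfl⟩, hx⟩
        refine ⟨r, hr, _, ⟨G.symm u, by simpa using hu, rfl⟩, g.injective ?_⟩
        rw [map_smul]
        change r • g (g.symm u) = g x
        rw [g.apply_symm_apply]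
        exact hx
    rw [himg]
    exact (g.measurePreserving : MeasurePreserving g.toHomeomorph.toMeasurableEquiv _ _
      ).measure_preimage_equiv _
  exact hG.integral_comp G.measurableEmbedding fun u => f u

theorem integral_surf_comp_neg (f : EuclideanSpace ℝ (Fin m) → F) :
    ∫ u : Sph, f (-u) ∂surf m = ∫ u : Sph, f u ∂surf m :=
  integral_surf_comp_isometry (LinearIsometryEquiv.neg ℝ) f

/-- Differentiation under the integral sign over the sphere. -/
theorem hasDerivAt_integral_surf [CompleteSpace F] {H H' : ℝ → Sph → F}
    (hc : ∀ t, Continuous (H t)) (hc' : Continuous (Function.uncurry H'))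
    (hd : ∀ t u, HasDerivAt (fun s => H s u) (H' t u) t) (t : ℝ) :
    HasDerivAt (fun s => ∫ u, H s u ∂surf m) (∫ u, H' t u ∂surf m) t := by
  -- Compactness of `[t-1, t+1]` times the sphere supplies a constant dominating function.
  obtain ⟨C, hC⟩ := ((isCompact_closedBall t 1).prod (isCompact_univ (X := Sph))
    ).exists_bound_of_continuousOn hc'.continuousOn
  refine (hasDerivAt_integral_of_dominated_loc_of_deriv_le (bound := fun _ => C)
    (Metric.ball_mem_nhds t one_pos)
    (Eventually.of_forall fun s => (hc s).aestronglyMeasurable) (integrable_surf (hc t))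
    (hc'.comp (by fun_prop : Continuous fun u : Sph => (t, u))).aestronglyMeasurable
    (Eventually.of_forall fun u s hs => ?_) (integrable_const _)
    (Eventually.of_forall fun u s _ => hd s u)).2
  exact hC (s, u) ⟨Metric.ball_subset_closedBall hs, mem_univ _⟩

/-! ### Infinitesimal rotations -/

/-- The rotation by the angle `t` in the plane of the coordinates `i` and `j`. -/
def planeRotation (i j : Fin m) (t : ℝ) : EuclideanSpace ℝ (Fin m) →ₗ[ℝ] EuclideanSpace ℝ (Fin m) where
  toFun x := x + (((Real.cos t - 1) * x i + Real.sin t * x j) • EuclideanSpace.single i (1 : ℝ)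
    + ((Real.cos t - 1) * x j - Real.sin t * x i) • EuclideanSpace.single j (1 : ℝ))
  map_add' x y := by
    simp only [PiLp.add_apply]
    module
  map_smul' c x := by
    simp only [PiLp.smul_apply, smul_eq_mul, RingHom.id_apply]
    module

theorem planeRotation_apply (i j : Fin m) (t : ℝ) (x : EuclideanSpace ℝ (Fin m)) :
    planeRotation i j t x
      = x + (((Real.cos t - 1) * x i + Real.sin t * x j) • EuclideanSpace.single i (1 : ℝ)
        + ((Real.cos t - 1) * x j - Real.sin t * x i) • EuclideanSpace.single j (1 : ℝ)) := rfl

theorem norm_planeRotation {i j : Fin m} (hij : i ≠ j) (t : ℝ) (x : EuclideanSpace ℝ (Fin m)) :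
    ‖planeRotation i j t x‖ = ‖x‖ := by
  refine (sq_eq_sq₀ (norm_nonneg _) (norm_nonneg _)).1 ?_
  rw [planeRotation_apply, norm_add_sq_real, norm_add_sq_real]
  simp only [inner_add_right, inner_smul_right, inner_smul_left, EuclideanSpace.inner_single_right,
    norm_smul, PiLp.norm_single, mul_pow, Real.norm_eq_abs, sq_abs]
  simp [hij]
  linear_combination (x i ^ 2 + x j ^ 2) * Real.sin_sq_add_cos_sq t

/-- `planeRotation` as an isometry. -/
def planeRotationEquiv {i j : Fin m} (hij : i ≠ j) (t : ℝ) :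
    EuclideanSpace ℝ (Fin m) ≃ₗᵢ[ℝ] EuclideanSpace ℝ (Fin m) :=
  LinearIsometry.toLinearIsometryEquiv ⟨planeRotation i j t, norm_planeRotation hij t⟩ rfl

/-- The velocity of `planeRotation`. -/
def planeRotationVelocity (i j : Fin m) (t : ℝ) (x : EuclideanSpace ℝ (Fin m)) :
    EuclideanSpace ℝ (Fin m) :=
  (-Real.sin t * x i + Real.cos t * x j) • EuclideanSpace.single i (1 : ℝ)
    + (-Real.sin t * x j - Real.cos t * x i) • EuclideanSpace.single j (1 : ℝ)

theorem hasDerivAt_planeRotation (i j : Fin m) (t : ℝ) (x : EuclideanSpace ℝ (Fin m)) :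
    HasDerivAt (fun s => planeRotation i j s x) (planeRotationVelocity i j t x) t := by
  simp only [planeRotation_apply, planeRotationVelocity]
  refine HasDerivAt.const_add _ (HasDerivAt.add ?_ ?_)
  · exact ((((Real.hasDerivAt_cos t).sub_const 1).mul_const _).add
      ((Real.hasDerivAt_sin t).mul_const _)).smul_const _
  · exact ((((Real.hasDerivAt_cos t).sub_const 1).mul_const _).sub
      ((Real.hasDerivAt_sin t).mul_const _)).smul_const _

theorem continuous_planeRotation (i j : Fin m) :
    Continuous fun p : ℝ × EuclideanSpace ℝ (Fin m) => planeRotation i j p.1 p.2 := by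
  simp only [planeRotation_apply]
  fun_prop

theorem continuous_planeRotationVelocity (i j : Fin m) :
    Continuous fun p : ℝ × EuclideanSpace ℝ (Fin m) => planeRotationVelocity i j p.1 p.2 := by
  simp only [planeRotationVelocity]
  fun_prop

theorem planeRotationEquiv_apply {i j : Fin m} (hij : i ≠ j) (t : ℝ)
    (x : EuclideanSpace ℝ (Fin m)) : planeRotationEquiv hij t x = planeRotation i j t x := rfl

theorem planeRotationVelocity_zero (i j : Fin m) (x : EuclideanSpace ℝ (Fin m)) :
    planeRotationVelocity i j 0 x
      = x j • EuclideanSpace.single i (1 : ℝ) - x i • EuclideanSpace.single j (1 : ℝ) := by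
  simp [planeRotationVelocity, sub_eq_add_neg]

theorem planeRotation_zero (i j : Fin m) (x : EuclideanSpace ℝ (Fin m)) :
    planeRotation i j 0 x = x := by
  simp [planeRotation_apply]

attribute [irreducible] planeRotation planeRotationVelocity planeRotationEquiv

/-- The vector field `x_j ∂_i - x_i ∂_j` generates rotations, so that it annihilates spherical
means. -/
theorem integral_surf_rotation {f : EuclideanSpace ℝ (Fin m) → ℝ} (hf : ContDiff ℝ 1 f)
    (i j : Fin m) :
    ∫ u : Sph, fderiv ℝ f u 
      (u.1 j • EuclideanSpace.single i (1 : ℝ) - u.1 i • EuclideanSpace.single j (1 : ℝ))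
      ∂surf m = 0 := by
  rcases eq_or_ne i j with rfl | hij
  · simp
  have hval : Continuous fun p : ℝ × Sph => (p.1, (p.2 : EuclideanSpace ℝ (Fin m))) := by fun_prop
  have hd := hasDerivAt_integral_surf (m := m) (H := fun t u => f (planeRotation i j t u))
    (H' := fun t u => fderiv ℝ f (planeRotation i j t u) (planeRotationVelocity i j t u))
    (fun t => hf.continuous.comp ((planeRotation i j t).continuous_of_finiteDimensional.comp
      continuous_subtype_val))
    (((hf.continuous_fderiv one_ne_zero).comp ((continuous_planeRotation i j).comp hval)).clm_apply
      ((continuous_planeRotationVelocity i j).comp hval))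
    (fun t u => ((hf.differentiable one_ne_zero) _).hasFDerivAt.comp_hasDerivAt t 
      (hasDerivAt_planeRotation i j t u)) 0
  -- By invariance of the surface measure the integral is constant in the angle, so the derivative
  -- at angle `0` is zero.
  have hconst : ∀ t : ℝ, ∫ u : Sph, f (planeRotation i j t u) ∂surf m = ∫ u : Sph, f u ∂surf m :=
    fun t => by simpa only [planeRotationEquiv_apply] using
      integral_surf_comp_isometry (planeRotationEquiv hij t) f
  simp_rw [hconst] at hd
  have h0 := hd.unique (hasDerivAt_const _ _)
  refine Eq.trans (integral_congr_ae (Eventually.of_forall fun u => ?_)) h0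
  rw [planeRotation_zero, planeRotationVelocity_zero]

/-! ### Weighted spherical means of test functions -/

/-- The unnormalized spherical mean of `φ` with weight `f`. -/
def sphMean (f : Sph → F) (φ : 𝓢(EuclideanSpace ℝ (Fin m), ℝ)) (r : ℝ) : F :=
  ∫ u : Sph, φ (r • u.1) • f u ∂surf m

theorem continuous_sphMean_integrand {f : Sph → F} (hf : Continuous f)
    (φ : 𝓢(EuclideanSpace ℝ (Fin m), ℝ)) (r : ℝ) :
    Continuous fun u : Sph => φ (r • u.1) • f u :=
  (φ.continuous.comp (by fun_prop)).smul hf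

/-- The derivative is again a sum of weighted means of test functions. Arbitrary continuous weights
are allowed precisely so that this class is closed under differentiation and smoothness follows by
induction. -/
theorem hasDerivAt_sphMean [CompleteSpace F] {f : Sph → F} (hf : Continuous f)
    (φ : 𝓢(EuclideanSpace ℝ (Fin m), ℝ)) (r : ℝ) :
    HasDerivAt (sphMean f φ) (∑ j : Fin m,
      sphMean (fun u => u.1 j • f u) (∂_{EuclideanSpace.single j (1 : ℝ)} φ) r) r := by
  have hd := hasDerivAt_integral_surf (m := m) (H := fun t u => φ (t • u.1) • f u)
    (H' := fun t u => ∑ j : Fin m,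
      (∂_{EuclideanSpace.single j (1 : ℝ)} φ) (t • u.1) • u.1 j • f u)
    (fun t => continuous_sphMean_integrand hf φ t)
    (continuous_finsetSum _ fun j _ =>
      ((∂_{EuclideanSpace.single j (1 : ℝ)} φ).continuous.comp (by fun_prop)).smul
        (Continuous.smul (by fun_prop) (hf.comp continuous_snd)))
    (fun t u => by
      have h1 : HasDerivAt (fun s : ℝ => s • u.1) u.1 t := by
        simpa using (hasDerivAt_id t).smul_const u.1
      have h2 := (φ.hasFDerivAt (t • u.1)).comp_hasDerivAt t h1
      refine (h2.smul_const (f u)).congr_deriv ?_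
      simp_rw [SchwartzMap.lineDerivOp_apply_eq_fderiv, smul_smul, ← Finset.sum_smul]
      congr 1
      generalize fderiv ℝ φ (t • u.1) = L
      conv_lhs => rw [← (EuclideanSpace.basisFun (Fin m) ℝ).sum_repr u.1]
      simp [mul_comm]) r
  rw [integral_finsetSum _ fun j _ => integrable_surf (continuous_sphMean_integrand
    (f := fun u : Sph => u.1 j • f u) (by fun_prop) _ r)] at hd
  exact hd

theorem contDiff_sphMean [CompleteSpace F] {f : Sph → F} (hf : Continuous f)
    (φ : 𝓢(EuclideanSpace ℝ (Fin m), ℝ)) : ContDiff ℝ ∞ (sphMean f φ) := by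
  refine contDiff_infty.2 fun n => ?_
  induction n generalizing f φ with
  | zero => exact contDiff_zero.2 (continuous_iff_continuousAt.2 fun r =>
      (hasDerivAt_sphMean hf φ r).continuousAt)
  | succ n ih =>
    have : deriv (sphMean f φ) = fun r => ∑ j : Fin m,
        sphMean (fun u => u.1 j • f u) (∂_{EuclideanSpace.single j (1 : ℝ)} φ) r :=
      funext fun r => (hasDerivAt_sphMean hf φ r).deriv
    refine contDiff_succ_iff_deriv.2 ⟨fun r => (hasDerivAt_sphMean hf φ r).differentiableAt,
      fun h => (WithTop.natCast_ne_top n h).elim, ?_⟩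
    rw [this]
    exact ContDiff.sum fun j _ => ih (by fun_prop) _

theorem exists_norm_sphMean_le {f : Sph → F} (hf : Continuous f)
    (φ : 𝓢(EuclideanSpace ℝ (Fin m), ℝ)) : ∃ C, ∀ r, ‖sphMean f φ r‖ ≤ C * (1 + r ^ 2)⁻¹ := by
  obtain ⟨B, hB⟩ := (isCompact_univ (X := Sph)).exists_bound_of_continuousOn hf.continuousOn
  set K := SchwartzMap.seminorm ℝ 0 0 φ + SchwartzMap.seminorm ℝ 2 0 φ
  refine ⟨K * |B| * (surf m).real univ, fun r => ?_⟩
  have hpt : ∀ u : Sph, ‖φ (r • u.1) • f u‖ ≤ K * |B| * (1 + r ^ 2)⁻¹ := by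
    intro u
    have h1 := SchwartzMap.norm_le_seminorm ℝ φ (r • u.1)
    have h2 := SchwartzMap.norm_pow_mul_le_seminorm ℝ φ 2 (r • u.1)
    have hu : ‖r • u.1‖ ^ 2 = r ^ 2 := by simp [norm_smul]
    rw [hu] at h2
    have h3 : ‖φ (r • u.1)‖ ≤ K * (1 + r ^ 2)⁻¹ := by
      rw [← div_eq_mul_inv, le_div_iff₀ (by positivity)]
      linarith
    rw [norm_smul, mul_right_comm]
    exact mul_le_mul h3 ((hB u (mem_univ _)).trans (le_abs_self B)) (norm_nonneg _)
      ((norm_nonneg _).trans h3)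
  have := norm_integral_le_of_norm_le_const (μ := surf m) (Eventually.of_forall hpt)
  exact this.trans (le_of_eq (by ring))

/-- The antipodal map preserves surface measure; the parity of the weight becomes the parity of the
mean in `r`. -/
theorem sphMean_neg (f : EuclideanSpace ℝ (Fin m) → F) (φ : 𝓢(EuclideanSpace ℝ (Fin m), ℝ))
    (r : ℝ) : sphMean (fun u : Sph => f u) φ (-r) = sphMean (fun u : Sph => f (-u.1)) φ r := by
  rw [sphMean, sphMean, ← integral_surf_comp_neg fun x => φ (-r • x) • f x]
  simp

/-! ### The Dirac operator and spherical means -/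

/-- The rotation field `x_j ∂_i - x_i ∂_j` is applied to `x ↦ φ (r x)`. The factor `r` from the
chain rule is kept, which includes `r = 0`. -/
theorem sphMean_rotation (φ : 𝓢(EuclideanSpace ℝ (Fin m), ℝ)) (r : ℝ) (i j : Fin m) :
    r * sphMean (fun u : Sph => u.1 i) (∂_{EuclideanSpace.single j (1 : ℝ)} φ) r
      = r * sphMean (fun u : Sph => u.1 j) (∂_{EuclideanSpace.single i (1 : ℝ)} φ) r := by
  have hd : ∀ x : EuclideanSpace ℝ (Fin m), HasFDerivAt (fun x => φ (r • x))
      ((fderiv ℝ φ (r • x)).comp (r • ContinuousLinearMap.id ℝ _)) x := fun x =>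
    (φ.hasFDerivAt (r • x)).comp x ((hasFDerivAt_id x).const_smul r)
  have h := integral_surf_rotation (f := fun x => φ (r • x))
    ((φ.smooth 1).comp (contDiff_const_smul r)) i j
  simp only [(hd _).fderiv] at h
  rw [eq_comm, ← sub_eq_zero, ← h, sphMean, sphMean, ← integral_const_mul, ← integral_const_mul,
    ← integral_sub]
  · refine integral_congr_ae (Eventually.of_forall fun u => ?_)
    simp [SchwartzMap.lineDerivOp_apply_eq_fderiv]
    ring
  · exact (integrable_surf (continuous_sphMean_integrand (by fun_prop) _ r)).const_mul r
  · exact (integrable_surf (continuous_sphMean_integrand (by fun_prop) _ r)).const_mul r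

/-- Apply `x_j ∂_i - x_i ∂_j` to `x ↦ x_j φ (r x)` and sum over `j`. Differentiating `x_j` gives
`(δ_{ij} - 1) x_i φ`, in total `-(m-1) x_i φ`; differentiating `φ` gives `r ∂_i φ - r x_i ∑_j x_j
∂_j φ`, because `∑ x_j² = 1` on the sphere. -/
theorem sphMean_partial (φ : 𝓢(EuclideanSpace ℝ (Fin m), ℝ)) (r : ℝ) (i : Fin m) :
    r * sphMean (fun _ : Sph => (1 : ℝ)) (∂_{EuclideanSpace.single i (1 : ℝ)} φ) r
      = r * ∑ j : Fin m, sphMean (fun u : Sph => u.1 j * u.1 i)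
          (∂_{EuclideanSpace.single j (1 : ℝ)} φ) r
        + ((m : ℝ) - 1) * sphMean (fun u : Sph => u.1 i) φ r := by
  have hd : ∀ (j : Fin m) (x : EuclideanSpace ℝ (Fin m)), HasFDerivAt (fun x => x j * φ (r • x))
      (x j • ((fderiv ℝ φ (r • x)).comp (r • ContinuousLinearMap.id ℝ _))
        + φ (r • x) • (EuclideanSpace.proj j : EuclideanSpace ℝ (Fin m) →L[ℝ] ℝ)) x := fun j x =>
    (EuclideanSpace.proj j : EuclideanSpace ℝ (Fin m) →L[ℝ] ℝ).hasFDerivAt.mul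
      ((φ.hasFDerivAt (r • x)).comp x ((hasFDerivAt_id x).const_smul r))
  have hfd : ∀ (j : Fin m) (x v : EuclideanSpace ℝ (Fin m)),
      fderiv ℝ (fun x : EuclideanSpace ℝ (Fin m) => x j * φ (r • x)) x v
        = x j * (r * fderiv ℝ φ (r • x) v) + φ (r • x) * v j := fun j x v => by
    rw [(hd j x).fderiv]
    simp
  have h : ∀ j : Fin m, _ := fun j => integral_surf_rotation (f := fun x => x j * φ (r • x))
    (ContDiff.mul (f := fun x : EuclideanSpace ℝ (Fin m) => x j) (g := fun x => φ (r • x))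
      (EuclideanSpace.proj j : EuclideanSpace ℝ (Fin m) →L[ℝ] ℝ).contDiff
      ((φ.smooth 1).comp (contDiff_const_smul r))) i j
  set D := fun (j : Fin m) (u : Sph) => (∂_{EuclideanSpace.single j (1 : ℝ)} φ) (r • u.1) with hD
  have hDc : ∀ j, Continuous (D j) := fun j =>
    (∂_{EuclideanSpace.single j (1 : ℝ)} φ).continuous.comp (by fun_prop)
  have hφc : Continuous fun u : Sph => φ (r • u.1) := φ.continuous.comp (by fun_prop)
  have hsum : ∫ u : Sph, ∑ j : Fin m, (((if i = j then (1 : ℝ) else 0) - 1) * (φ (r • u.1) * u.1 i)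
      + r * (u.1 j * u.1 j * D i u - D j u * (u.1 j * u.1 i))) ∂surf m = 0 := by
    rw [integral_finsetSum _ fun j _ => integrable_surf (by fun_prop)]
    refine Finset.sum_eq_zero fun j _ => ?_
    refine Eq.trans (integral_congr_ae (Eventually.of_forall fun u => ?_)) (h j)
    rcases eq_or_ne i j with rfl | hij
    · simp
      right
      ring
    · rw [hfd, hD]
      simp [SchwartzMap.lineDerivOp_apply_eq_fderiv, hij.symm, hij]
      ring
  have hpt : ∀ u : Sph, ∑ j : Fin m, (((if i = j then (1 : ℝ) else 0) - 1) * (φ (r • u.1) * u.1 i)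
      + r * (u.1 j * u.1 j * D i u - D j u * (u.1 j * u.1 i)))
      = r * (D i u * 1) - (r * ∑ j, D j u * (u.1 j * u.1 i)
        + ((m : ℝ) - 1) * (φ (r • u.1) * u.1 i)) := by
    intro u
    have hu : ∑ j : Fin m, u.1 j * u.1 j = 1 := by
      have := EuclideanSpace.real_norm_sq_eq u.1
      rw [norm_eq_of_mem_sphere, one_pow] at this
      simp_rw [this, sq]
    rw [Finset.sum_add_distrib, ← Finset.sum_mul, ← Finset.mul_sum, Finset.sum_sub_distrib,
      Finset.sum_sub_distrib, ← Finset.sum_mul, hu]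
    simp
    ring
  simp_rw [hpt] at hsum
  rw [integral_sub (integrable_surf (by fun_prop)) (integrable_surf (by fun_prop)),
    integral_add (integrable_surf (by fun_prop)) (integrable_surf (by fun_prop)),
    integral_const_mul, integral_const_mul, integral_const_mul,
    integral_finsetSum _ fun j _ => integrable_surf (by fun_prop), sub_eq_zero] at hsum
  exact hsum

end Sphere

/-! ### Calculus of Hadamard finite parts -/

section HadamardCalculus

variable {F F' : Type*} [NormedAddCommGroup F] [NormedSpace ℝ F]
  [NormedAddCommGroup F'] [NormedSpace ℝ F']

/-- Smooth functions on the line that are integrable with their derivative and vanish at `∞`. -/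
structure IsRadialTest (ψ : ℝ → F) : Prop where
  contDiff : ContDiff ℝ ∞ ψ
  integrable : Integrable ψ
  integrable_deriv : Integrable (deriv ψ)
  tendsto : Tendsto ψ atTop (𝓝 0)

theorem integrableOn_zpow_smul {ψ : ℝ → F} (hψ : Integrable ψ) (n : ℕ) {ε : ℝ} (hε : 0 < ε) :
    IntegrableOn (fun r : ℝ => r ^ (-(n : ℤ)) • ψ r) (Ioi ε) := by
  refine ((hψ.norm.const_mul (ε ^ n)⁻¹).integrableOn (s := Ioi ε)).mono' ?_ ?_
  · refine AEStronglyMeasurable.smul ?_ hψ.aestronglyMeasurable.restrict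
    simp_rw [zpow_neg, zpow_natCast]
    exact Measurable.aestronglyMeasurable (by fun_prop)
  · refine (ae_restrict_iff' measurableSet_Ioi).2 (Eventually.of_forall fun r hr => ?_)
    have hr' : ε < r := hr
    have h0 : 0 < r := hε.trans hr'
    rw [norm_smul, zpow_neg, zpow_natCast, norm_inv, norm_pow, Real.norm_of_nonneg h0.le]
    gcongr

theorem iteratedDeriv_clm_comp (L : F →L[ℝ] F') {ψ : ℝ → F} (hψ : ContDiff ℝ ∞ ψ) (k : ℕ) (r : ℝ) :
    iteratedDeriv k (fun r => L (ψ r)) r = L (iteratedDeriv k ψ r) := by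
  induction k generalizing r with
  | zero => simp
  | succ k ih =>
    rw [iteratedDeriv_succ, iteratedDeriv_succ, funext ih]
    exact (L.hasFDerivAt.comp_hasDerivAt r
      ((hψ.differentiable_iteratedDeriv k (by exact_mod_cast WithTop.coe_lt_top _) r
        ).hasDerivAt)).deriv

/-- Linearity holds already for every fixed `ε`. It lets the Clifford coefficients of the Dirac
operator move inside the finite part. -/
theorem hadamardReg_sum_clm [CompleteSpace F] [CompleteSpace F'] {ι : Type*} (s : Finset ι)
    (L : ι → F →L[ℝ] F') {ψ : ι → ℝ → F} (hψ : ∀ i ∈ s, IsRadialTest (ψ i)) (n : ℕ) {ε : ℝ}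
    (hε : 0 < ε) :
    hadamardReg (-(n : ℤ)) (fun r => ∑ i ∈ s, L i (ψ i r)) ε
      = ∑ i ∈ s, L i (hadamardReg (-(n : ℤ)) (ψ i) ε) := by
  have hint : ∀ i ∈ s, IntegrableOn (fun r : ℝ => r ^ (-(n : ℤ)) • ψ i r) (Ioi ε) := fun i hi =>
    integrableOn_zpow_smul (hψ i hi).integrable n hε
  have h1 : ∫ r in Ioi ε, r ^ (-(n : ℤ)) • ∑ i ∈ s, L i (ψ i r)
      = ∑ i ∈ s, L i (∫ r in Ioi ε, r ^ (-(n : ℤ)) • ψ i r) := by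
    simp_rw [Finset.smul_sum, ← map_smul]
    rw [integral_finsetSum _ fun i hi => (L i).integrable_comp (hint i hi)]
    exact Finset.sum_congr rfl fun i hi => (L i).integral_comp_comm (hint i hi)
  have h2 : ∀ k, iteratedDeriv k (fun r => ∑ i ∈ s, L i (ψ i r)) 0
      = ∑ i ∈ s, L i (iteratedDeriv k (ψ i) 0) := fun k => by
    refine (iteratedDeriv_fun_sum (f := fun i r => L i (ψ i r)) fun i hi =>
      ((L i).contDiff.comp (hψ i hi).contDiff).contDiffAt.of_le (by exact_mod_cast le_top)).trans ?_
    exact Finset.sum_congr rfl fun i hi => iteratedDeriv_clm_comp (L i) (hψ i hi).contDiff k 0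
  rw [hadamardReg, h1]
  simp only [hadamardReg, h2, map_add, map_sum, map_smul, Finset.smul_sum,
    Finset.sum_add_distrib]
  rw [Finset.sum_comm]

/-- Leibniz' rule; at `r = 0` it reads off the Taylor coefficients of `G` from those of `r G`
without dividing by `r`. -/
theorem iteratedDeriv_succ_id_smul {G : ℝ → F} (hG : ContDiff ℝ ∞ G) (k : ℕ) (r : ℝ) :
    iteratedDeriv (k + 1) (fun r => r • G r) r
      = r • iteratedDeriv (k + 1) G r + ((k : ℝ) + 1) • iteratedDeriv k G r := by
  have hd : ∀ (k : ℕ) (r : ℝ), HasDerivAt (iteratedDeriv k G) (iteratedDeriv (k + 1) G r) r := by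
    intro k r
    rw [iteratedDeriv_succ]
    exact (hG.differentiable_iteratedDeriv k (by exact_mod_cast WithTop.coe_lt_top _) r).hasDerivAt
  induction k generalizing r with
  | zero =>
    rw [iteratedDeriv_one]
    have := (hasDerivAt_id r).smul (hd 0 r)
    simp only [iteratedDeriv_zero] at this ⊢
    refine Eq.trans this.deriv ?_
    simp
  | succ k ih =>
    rw [iteratedDeriv_succ, funext ih]
    have := ((hasDerivAt_id r).smul (hd (k + 1) r)).add ((hd k r).const_smul ((k : ℝ) + 1))
    refine Eq.trans this.deriv ?_
    push_cast
    simp only [id]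
    module

/-- The Taylor remainder is `O(ε^{n+1})`. The expression is exactly the error left by integration by
parts in `tendsto_hadamardReg_sub`. -/
theorem tendsto_taylor_remainder {ψ : ℝ → F} (hψ : ContDiff ℝ ∞ ψ) (n : ℕ) :
    Tendsto (fun ε : ℝ => (ε ^ n)⁻¹ • ((∑ k ∈ Finset.range (n + 1),
      (ε ^ k / (k.factorial : ℝ)) • iteratedDeriv k ψ 0) - ψ ε)) (𝓝[>] 0) (𝓝 0) := by
  obtain ⟨C, hC⟩ := exists_taylor_mean_remainder_bound (f := ψ) (n := n) (zero_le_one' ℝ)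
    (hψ.contDiffOn.of_le (by exact_mod_cast le_top))
  have hev : ∀ᶠ ε : ℝ in 𝓝[>] 0, ε ∈ Ioo (0 : ℝ) 1 := Ioo_mem_nhdsGT one_pos
  have hlim : Tendsto (fun ε : ℝ => C * ε) (𝓝[>] 0) (𝓝 0) := by
    have : Tendsto (fun ε : ℝ => C * ε) (𝓝 0) (𝓝 (C * 0)) := tendsto_id.const_mul C
    rw [mul_zero] at this
    exact this.mono_left nhdsWithin_le_nhds
  refine squeeze_zero_norm' (hev.mono fun ε hε => ?_) hlim
  have h := hC ε ⟨hε.1.le, hε.2.le⟩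
  have hT : taylorWithinEval ψ n (Icc 0 1) 0 ε = ∑ k ∈ Finset.range (n + 1),
      (ε ^ k / (k.factorial : ℝ)) • iteratedDeriv k ψ 0 := by
    rw [taylor_within_apply]
    refine Finset.sum_congr rfl fun k _ => ?_
    rw [iteratedDerivWithin_eq_iteratedDeriv (uniqueDiffOn_Icc one_pos)
      (hψ.contDiffAt.of_le (by exact_mod_cast le_top)) ⟨le_rfl, zero_le_one⟩, sub_zero,
      div_eq_inv_mul]
  rw [hT, sub_zero, norm_sub_rev] at h
  have hpos : 0 < ε ^ n := pow_pos hε.1 n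
  rw [norm_smul, norm_inv, Real.norm_of_nonneg hpos.le, inv_mul_le_iff₀ hpos]
  refine h.trans (le_of_eq ?_)
  ring

/-- The relation for `G` says `r^{-n} G = (r^{-n} ψ)' + (c + n) r^{-n-1} ψ`, and the total
derivative contributes only its value at the endpoint `ε`. -/
theorem integral_zpow_smul_Ioi [CompleteSpace F] {ψ G : ℝ → F} (hψ : IsRadialTest ψ) {c : ℝ}
    (hG : ∀ r : ℝ, r • G r = r • deriv ψ r + c • ψ r) {n : ℕ} (hn : n ≠ 0) {ε : ℝ} (hε : 0 < ε) :
    ∫ r in Ioi ε, r ^ (-(n : ℤ)) • G r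
      = (c + n) • (∫ r in Ioi ε, r ^ (-((n + 1 : ℕ) : ℤ)) • ψ r) - (ε ^ n)⁻¹ • ψ ε := by
  have hd : ∀ r ∈ Ici ε, HasDerivAt (fun r : ℝ => r ^ (-(n : ℤ)) • ψ r)
      (r ^ (-(n : ℤ)) • deriv ψ r - (n : ℝ) • r ^ (-((n + 1 : ℕ) : ℤ)) • ψ r) r := by
    intro r hr
    have hr0 : r ≠ 0 := (hε.trans_le hr).ne'
    have h1 := (hasDerivAt_zpow (-(n : ℤ)) r (Or.inl hr0)).smul
      ((hψ.contDiff.differentiable (by simp)) r).hasDerivAt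
    refine h1.congr_deriv ?_
    have : -(n : ℤ) - 1 = -((n + 1 : ℕ) : ℤ) := by push_cast; ring
    rw [this]
    push_cast
    module
  have hi1 := integrableOn_zpow_smul hψ.integrable_deriv n hε
  have hi2 := integrableOn_zpow_smul hψ.integrable (n + 1) hε
  have hlim : Tendsto (fun r : ℝ => r ^ (-(n : ℤ)) • ψ r) atTop (𝓝 0) := by
    have h := (tendsto_pow_neg_atTop (𝕜 := ℝ) hn).smul hψ.tendsto
    rw [smul_zero] at h
    exact h
  have hi3 : IntegrableOn (fun r => r ^ (-(n : ℤ)) • deriv ψ r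
      - (n : ℝ) • r ^ (-((n + 1 : ℕ) : ℤ)) • ψ r) (Ioi ε) := hi1.sub (hi2.smul (n : ℝ))
  have hi4 : IntegrableOn (fun r => (c + n) • r ^ (-((n + 1 : ℕ) : ℤ)) • ψ r) (Ioi ε) :=
    hi2.smul (c + n)
  have hFTC := integral_Ioi_of_hasDerivAt_of_tendsto' hd hi3 hlim
  have hsplit : ∀ r ∈ Ioi ε, r ^ (-(n : ℤ)) • G r
      = (r ^ (-(n : ℤ)) • deriv ψ r - (n : ℝ) • r ^ (-((n + 1 : ℕ) : ℤ)) • ψ r)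
        + (c + n) • r ^ (-((n + 1 : ℕ) : ℤ)) • ψ r := by
    intro r hr
    have hr0 : r ≠ 0 := (hε.trans hr).ne'
    have h1 : r ^ (-(n : ℤ)) = r ^ (-((n + 1 : ℕ) : ℤ)) * r := by
      rw [← zpow_add_one₀ hr0]; congr 1; push_cast; ring
    have h2 : r ^ (-(n : ℤ)) • G r
        = r ^ (-((n + 1 : ℕ) : ℤ)) • (r • deriv ψ r + c • ψ r) := by
      rw [h1, mul_smul, hG]
    rw [h2, h1]
    module
  rw [setIntegral_congr_fun measurableSet_Ioi hsplit,
    integral_add hi3 hi4, hFTC, integral_smul, zpow_neg,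
    zpow_natCast]
  abel

/-- If `r G = r ψ' + c ψ` then `Fp ∫ r^{-n} G = (c + n) Fp ∫ r^{-n-1} ψ`, provided that the
`n`-th derivative of `ψ` vanishes at the origin. -/
theorem tendsto_hadamardReg_sub [CompleteSpace F] {ψ G : ℝ → F} (hψ : IsRadialTest ψ)
    (hGs : ContDiff ℝ ∞ G) {c : ℝ} (hG : ∀ r : ℝ, r • G r = r • deriv ψ r + c • ψ r) {n : ℕ}
    (hn : n ≠ 0) (h0 : iteratedDeriv n ψ 0 = 0) :
    Tendsto (fun ε => hadamardReg (-(n : ℤ)) G ε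
      - (c + n) • hadamardReg (-((n + 1 : ℕ) : ℤ)) ψ ε) (𝓝[>] 0) (𝓝 0) := by
  refine (tendsto_taylor_remainder hψ.contDiff n).congr' ?_
  filter_upwards [self_mem_nhdsWithin] with ε hε
  have hε' : 0 < ε := hε
  have hψ' : ContDiff ℝ ∞ (deriv ψ) := (contDiff_infty_iff_deriv.1 hψ.contDiff).2
  -- Compare the derivatives of order `k + 1` at the origin on the two sides of `r G = r ψ' + c ψ`.
  have hk : ∀ k : ℕ, ((k : ℝ) + 1) • iteratedDeriv k G 0
      = ((k : ℝ) + 1 + c) • iteratedDeriv (k + 1) ψ 0 := by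
    intro k
    have h1 := iteratedDeriv_succ_id_smul hGs k 0
    have h2 := iteratedDeriv_succ_id_smul hψ' k 0
    have hs : iteratedDeriv (k + 1) (fun r => r • G r) 0
        = iteratedDeriv (k + 1) (fun r => r • deriv ψ r) 0 + c • iteratedDeriv (k + 1) ψ 0 := by
      rw [funext hG]
      have ha : ContDiff ℝ ∞ fun r : ℝ => r • deriv ψ r := contDiff_id.smul hψ'
      have hb : ContDiff ℝ ∞ fun r : ℝ => c • ψ r := hψ.contDiff.const_smul c
      refine (iteratedDeriv_fun_add (ha.contDiffAt.of_le (by exact_mod_cast le_top))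
        (hb.contDiffAt.of_le (by exact_mod_cast le_top))).trans ?_
      rw [iteratedDeriv_fun_const_smul_field]
    rw [hs, h2, zero_smul, zero_smul, zero_add, zero_add, ← iteratedDeriv_succ'] at h1
    rw [← h1, ← add_smul]
  have hc0 : c • ψ 0 = 0 := by simpa using (hG 0).symm
  set L : ℕ → ℝ := fun k => if -(n : ℤ) + k + 1 = 0 then Real.log ε
    else ε ^ (-(n : ℤ) + k + 1) / (((-(n : ℤ) : ℤ) : ℝ) + k + 1) with hL
  have hS1 : hadamardReg (-(n : ℤ)) G ε = (∫ r in Ioi ε, r ^ (-(n : ℤ)) • G r)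
      + ∑ k ∈ Finset.range n, (L k / (k.factorial : ℝ)) • iteratedDeriv k G 0 := by
    simp [hadamardReg, hL]
  -- The counterterm of index `k + 1` at order `n + 1` has the same power of `ε` as that of index
  -- `k` at order `n`; only index `0` is unmatched.
  have hS2 : hadamardReg (-((n + 1 : ℕ) : ℤ)) ψ ε
      = (∫ r in Ioi ε, r ^ (-((n + 1 : ℕ) : ℤ)) • ψ r)
        + (∑ k ∈ Finset.range n, (L k / ((k + 1).factorial : ℝ)) • iteratedDeriv (k + 1) ψ 0
          + (-((ε ^ n)⁻¹ / n)) • ψ 0) := by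
    have hnat : (- -((n + 1 : ℕ) : ℤ)).toNat = n + 1 := by simp
    rw [hadamardReg, hnat, Finset.sum_range_succ']
    congr 2
    · refine Finset.sum_congr rfl fun k _ => ?_
      have e1 : -((n + 1 : ℕ) : ℤ) + (k + 1 : ℕ) + 1 = -(n : ℤ) + k + 1 := by push_cast; ring
      have e2 : ((-((n + 1 : ℕ) : ℤ) : ℤ) : ℝ) + ((k + 1 : ℕ) : ℝ) + 1
          = ((-(n : ℤ) : ℤ) : ℝ) + k + 1 := by push_cast; ring
      rw [e1, e2]
    · have e1 : -((n + 1 : ℕ) : ℤ) + (0 : ℕ) + 1 = -(n : ℤ) := by push_cast; ring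
      have e2 : ((-((n + 1 : ℕ) : ℤ) : ℤ) : ℝ) + ((0 : ℕ) : ℝ) + 1 = -(n : ℝ) := by push_cast; ring
      rw [e1, e2, if_neg (by simpa using hn), zpow_neg, zpow_natCast, div_neg]
      simp
  have hn' : (n : ℝ) ≠ 0 := Nat.cast_ne_zero.2 hn
  have hterm : ∀ k ∈ Finset.range n, (ε ^ n)⁻¹ • (ε ^ (k + 1) / ((k + 1).factorial : ℝ)) •
      iteratedDeriv (k + 1) ψ 0 = (L k / (k.factorial : ℝ)) • iteratedDeriv k G 0
        - (c + n) • (L k / ((k + 1).factorial : ℝ)) • iteratedDeriv (k + 1) ψ 0 := by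
    intro k hkn
    have hk1 : ((k : ℝ) + 1) ≠ 0 := by positivity
    have hf : (((k + 1).factorial : ℕ) : ℝ) = ((k : ℝ) + 1) * (k.factorial : ℝ) := by
      rw [Nat.factorial_succ]; push_cast; ring
    have hfac : ((k.factorial : ℕ) : ℝ) ≠ 0 := by positivity
    have hGk : iteratedDeriv k G 0
        = (((k : ℝ) + 1 + c) / ((k : ℝ) + 1)) • iteratedDeriv (k + 1) ψ 0 := by
      rw [div_eq_inv_mul, mul_smul, ← hk, smul_smul, inv_mul_cancel₀ hk1, one_smul]
    rw [hGk, smul_smul, smul_smul, smul_smul, ← sub_smul]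
    -- The logarithmic index. Here the left side is `ψ^{(n)}(0)/n!`, which does not depend on `ε`
    -- and would survive in the limit were it not for `h0`.
    by_cases hkn' : k + 1 = n
    · rw [hkn', h0, smul_zero, smul_zero]
    · have hne : -(n : ℤ) + k + 1 ≠ 0 := by omega
      have hne' : ((-(n : ℤ) : ℤ) : ℝ) + k + 1 ≠ 0 := by exact_mod_cast hne
      have hz : ε ^ (-(n : ℤ) + k + 1) = (ε ^ n)⁻¹ * ε ^ (k + 1) := by
        rw [add_assoc, zpow_add₀ hε'.ne', zpow_neg, zpow_natCast]
        norm_cast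
      have hLk : L k * (k + 1 - n) = (ε ^ n)⁻¹ * ε ^ (k + 1) := by
        simp only [hL]
        rw [if_neg hne, hz, div_mul_eq_mul_div, div_eq_iff hne']
        push_cast
        ring
      congr 1
      rw [← mul_div_assoc, ← hLk, hf]
      field_simp
      ring
  -- Because `c ψ(0) = 0`, the unmatched counterterm is exactly the zeroth Taylor term.
  have h00 : (ε ^ n)⁻¹ • (ε ^ 0 / ((Nat.factorial 0 : ℕ) : ℝ)) • iteratedDeriv 0 ψ 0
      = -((c + n) • (-((ε ^ n)⁻¹ / n)) • ψ 0) := by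
    have : (c + n) • (-((ε ^ n)⁻¹ / n)) • ψ 0
        = (-((ε ^ n)⁻¹ / n)) • (c • ψ 0) - (ε ^ n)⁻¹ • ψ 0 := by
      rw [smul_smul, smul_smul, ← sub_smul]
      congr 1
      field_simp
      ring
    rw [this, hc0]
    simp
  rw [hS1, hS2, integral_zpow_smul_Ioi hψ hG hn hε', Finset.sum_range_succ', smul_sub, smul_add,
    Finset.smul_sum, Finset.sum_congr rfl hterm, h00, Finset.sum_sub_distrib, ← Finset.smul_sum]
  simp only [smul_add]
  abel

/-- Since `c + n ≠ 0`, the relation can be solved for the more singular integral: convergence of its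
finite part is inherited from the lower order. -/
theorem tendsto_hadamardReg_succ [CompleteSpace F] {ψ G : ℝ → F} (hψ : IsRadialTest ψ)
    (hGs : ContDiff ℝ ∞ G) {c : ℝ} (hG : ∀ r : ℝ, r • G r = r • deriv ψ r + c • ψ r) {n : ℕ}
    (hn : n ≠ 0) (h0 : iteratedDeriv n ψ 0 = 0) (hc : c + n ≠ 0) {l : F}
    (hl : Tendsto (hadamardReg (-(n : ℤ)) G) (𝓝[>] 0) (𝓝 l)) :
    Tendsto (hadamardReg (-((n + 1 : ℕ) : ℤ)) ψ) (𝓝[>] 0) (𝓝 ((c + n)⁻¹ • l)) := by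
  have h := (hl.sub (tendsto_hadamardReg_sub hψ hGs hG hn h0)).const_smul (c + n)⁻¹
  rw [sub_zero] at h
  refine h.congr fun ε => ?_
  rw [sub_sub_cancel, smul_smul, inv_mul_cancel₀ hc, one_smul]

theorem eq_zero_of_eq_neg_self {x : F} (h : x = -x) : x = 0 := by
  have : (2 : ℝ) • x = 0 := by
    rw [two_smul, ← eq_neg_iff_add_eq_zero]
    exact h
  exact (smul_eq_zero.1 this).resolve_left two_ne_zero

theorem iteratedDeriv_zero_of_even {ψ : ℝ → F} (h : ∀ r, ψ (-r) = ψ r) {n : ℕ} (hn : Odd n) :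
    iteratedDeriv n ψ 0 = 0 := by
  have := iteratedDeriv_comp_neg n ψ 0
  rw [funext h, neg_zero, hn.neg_one_pow, neg_one_smul] at this
  exact eq_zero_of_eq_neg_self this

theorem iteratedDeriv_zero_of_odd {ψ : ℝ → F} (h : ∀ r, ψ (-r) = -ψ r) {n : ℕ} (hn : Even n) :
    iteratedDeriv n ψ 0 = 0 := by
  have := iteratedDeriv_comp_neg n ψ 0
  rw [funext h, neg_zero, hn.neg_one_pow, one_smul, iteratedDeriv_fun_neg] at this
  exact eq_zero_of_eq_neg_self this.symm

end HadamardCalculus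

/-! ### Polar coordinates -/

section Polar

variable {m : ℕ} {F : Type*} [NormedAddCommGroup F] [NormedSpace ℝ F]

/-- Extending `g` by zero into the ball makes it integrable on the whole space, however singular it
is at the origin; Fubini in polar coordinates then applies. -/
theorem setIntegral_norm_gt_eq (hm : m ≠ 0) {ε : ℝ} (hε : 0 ≤ ε) {g : EuclideanSpace ℝ (Fin m) → F}
    (hg : IntegrableOn g {x | ε < ‖x‖}) :
    ∫ x in {x | ε < ‖x‖}, g x = ∫ r in Ioi ε, r ^ (m - 1) •
      ∫ u : Metric.sphere (0 : EuclideanSpace ℝ (Fin m)) 1, g (r • u.1) ∂surf m := by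
  have : NeZero m := ⟨hm⟩
  set S : Set (EuclideanSpace ℝ (Fin m)) := {x | ε < ‖x‖} with hS
  have hSm : MeasurableSet S := measurableSet_lt measurable_const measurable_norm
  set μ : Measure (EuclideanSpace ℝ (Fin m)) := volume with hμ
  set g' := S.indicator g with hg'
  have hgi : Integrable g' μ := hg.integrable_indicator hSm
  set P : Metric.sphere (0 : EuclideanSpace ℝ (Fin m)) 1 × Ioi (0 : ℝ) → F :=
    fun p => g' (p.2.1 • p.1.1) with hP
  have hcomp : ∀ x : ({0}ᶜ : Set (EuclideanSpace ℝ (Fin m))),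
      P (homeomorphUnitSphereProd (EuclideanSpace ℝ (Fin m)) x) = g' x := fun x => by
    have hx : ‖(x : EuclideanSpace ℝ (Fin m))‖ ≠ 0 := norm_ne_zero_iff.2 x.2
    simp [hP, smul_smul, hx]
  have hmp := μ.measurePreserving_homeomorphUnitSphereProd
  have hemb := (homeomorphUnitSphereProd (EuclideanSpace ℝ (Fin m))).measurableEmbedding
  have hPi : Integrable P ((surf m).prod (.volumeIoiPow (Module.finrank ℝ (EuclideanSpace ℝ (Fin m)) - 1))) := by
    refine (hmp.integrable_comp_emb hemb).1 ?_
    have : (P ∘ homeomorphUnitSphereProd (EuclideanSpace ℝ (Fin m))) = g' ∘ (↑) := funext hcomp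
    rw [this]
    refine (MeasurableEmbedding.integrable_map_iff
      (MeasurableEmbedding.subtype_coe (measurableSet_singleton _).compl)).1 ?_
    rw [map_comap_subtype_coe (measurableSet_singleton _).compl]
    exact hgi.restrict
  calc ∫ x in S, g x ∂μ = ∫ x, g' x ∂μ := (integral_indicator hSm).symm
    _ = ∫ x : ({0}ᶜ : Set (EuclideanSpace ℝ (Fin m))), g' x.1 ∂(μ.comap (↑)) := by
      rw [integral_subtype_comap (measurableSet_singleton _).compl g', restrict_compl_singleton]
    _ = ∫ p, P p ∂((surf m).prod (.volumeIoiPow (Module.finrank ℝ (EuclideanSpace ℝ (Fin m)) - 1))) := by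
      rw [← hmp.integral_comp hemb]
      exact integral_congr_ae (Eventually.of_forall fun x => (hcomp x).symm)
    _ = ∫ r : Ioi (0 : ℝ), (∫ u, g' (r.1 • u.1) ∂surf m)
          ∂.volumeIoiPow (Module.finrank ℝ (EuclideanSpace ℝ (Fin m)) - 1) :=
      integral_prod_symm _ hPi
    _ = ∫ r in Ioi (0 : ℝ), r ^ (m - 1) • ∫ u : Metric.sphere (0 : EuclideanSpace ℝ (Fin m)) 1,
          g' (r • u.1) ∂surf m := by
      simp only [Measure.volumeIoiPow, ENNReal.ofReal]
      rw [integral_withDensity_eq_integral_smul, integral_subtype_comap measurableSet_Ioi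
          fun a => Real.toNNReal (a ^ (Module.finrank ℝ (EuclideanSpace ℝ (Fin m)) - 1)) •
            ∫ u : Metric.sphere (0 : EuclideanSpace ℝ (Fin m)) 1, g' (a • u.1) ∂surf m,
        setIntegral_congr_fun measurableSet_Ioi fun x hx => ?_]
      · rw [finrank_euclideanSpace_fin]
        rw [NNReal.smul_def, Real.coe_toNNReal _ (pow_nonneg (le_of_lt hx) _)]
      · exact (measurable_subtype_coe.pow_const _).real_toNNReal
    _ = _ := by
      rw [← integral_indicator measurableSet_Ioi, ← integral_indicator measurableSet_Ioi]
      refine integral_congr_ae (Eventually.of_forall fun r => ?_)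
      have hmem : ∀ u : Metric.sphere (0 : EuclideanSpace ℝ (Fin m)) 1, 0 < r →
          (r • u.1 ∈ S ↔ ε < r) := fun u hr => by
        simp [hS, norm_smul, abs_of_pos hr]
      by_cases h0 : r ∈ Ioi (0 : ℝ)
      · by_cases h1 : r ∈ Ioi ε
        · rw [indicator_of_mem h0, indicator_of_mem h1]
          congr 1
          refine integral_congr_ae (Eventually.of_forall fun u => ?_)
          exact indicator_of_mem ((hmem u h0).2 h1) _
        · rw [indicator_of_mem h0, indicator_of_notMem h1]
          have : ∀ u : Metric.sphere (0 : EuclideanSpace ℝ (Fin m)) 1, g' (r • u.1) = 0 :=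
            fun u => indicator_of_notMem (fun h => h1 ((hmem u h0).1 h)) _
          simp [this]
      · have h1 : r ∉ Ioi ε := fun h => h0 (hε.trans_lt h)
        rw [indicator_of_notMem h0, indicator_of_notMem h1]

end Polar

/-! ### Spherical means of test functions -/

section Means

variable {m : ℕ}

theorem isRadialTest_sphMean {F : Type*} [NormedAddCommGroup F] [NormedSpace ℝ F] [CompleteSpace F]
    {f : Metric.sphere (0 : EuclideanSpace ℝ (Fin m)) 1 → F} (hf : Continuous f)
    (φ : 𝓢(EuclideanSpace ℝ (Fin m), ℝ)) : IsRadialTest (sphMean f φ) := by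
  have hint : ∀ {f : Metric.sphere (0 : EuclideanSpace ℝ (Fin m)) 1 → F} (_ : Continuous f)
      (φ : 𝓢(EuclideanSpace ℝ (Fin m), ℝ)), Integrable (sphMean f φ) := fun {f} hf φ => by
    obtain ⟨C, hC⟩ := exists_norm_sphMean_le hf φ
    exact (integrable_inv_one_add_sq.const_mul C).mono'
      (contDiff_sphMean hf φ).continuous.aestronglyMeasurable (Eventually.of_forall hC)
  refine ⟨contDiff_sphMean hf φ, hint hf φ, ?_, ?_⟩
  · rw [funext fun r => (hasDerivAt_sphMean hf φ r).deriv]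
    exact integrable_finsetSum _ fun j _ => hint (by fun_prop) _
  · obtain ⟨C, hC⟩ := exists_norm_sphMean_le hf φ
    refine squeeze_zero_norm hC ?_
    rw [← mul_zero C]
    refine Tendsto.const_mul C (tendsto_inv_atTop_zero.comp ?_)
    exact tendsto_atTop_add_const_left _ _ (tendsto_pow_atTop two_ne_zero)

theorem sphMean_sum_smul {ι : Type*} (s : Finset ι) {F : Type*} [NormedAddCommGroup F]
    [NormedSpace ℝ F] [CompleteSpace F]
    {f : ι → Metric.sphere (0 : EuclideanSpace ℝ (Fin m)) 1 → ℝ}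
    (hf : ∀ i, Continuous (f i)) (c : ι → F) (φ : 𝓢(EuclideanSpace ℝ (Fin m), ℝ)) (r : ℝ) :
    sphMean (fun u => ∑ i ∈ s, f i u • c i) φ r = ∑ i ∈ s, sphMean (f i) φ r • c i := by
  have h : ∀ i, sphMean (f i) φ r • c i = ∫ u, (φ (r • u.1) * f i u) • c i ∂surf m :=
    fun i => (integral_smul_const _ _).symm
  rw [Finset.sum_congr rfl fun i _ => h i, ← integral_finsetSum, sphMean]
  · simp_rw [Finset.smul_sum, smul_smul]
  · exact fun i _ => (integrable_surf (continuous_sphMean_integrand (hf i) φ r)).smul_const (c i)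

theorem sphericalMean0_eq_sphMean (φ : 𝓢(EuclideanSpace ℝ (Fin m), ℝ)) :
    sphericalMean0 φ = sphMean (fun _ => (1 / sphereArea m) • (1 : Cl m)) φ := by
  ext1 r
  rw [sphericalMean0, sphMean, ← integral_smul]
  simp_rw [smul_comm (1 / sphereArea m)]

theorem sphericalMean1_eq_sphMean (φ : 𝓢(EuclideanSpace ℝ (Fin m), ℝ)) :
    sphericalMean1 φ = sphMean (fun u => (1 / sphereArea m) • vec m u.1) φ := by
  ext1 r
  rw [sphericalMean1, sphMean, ← integral_smul]
  simp_rw [smul_comm (1 / sphereArea m)]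

theorem isRadialTest_sphericalMean0 (φ : 𝓢(EuclideanSpace ℝ (Fin m), ℝ)) :
    IsRadialTest (sphericalMean0 φ) := by
  rw [sphericalMean0_eq_sphMean]
  exact isRadialTest_sphMean continuous_const φ

theorem isRadialTest_sphericalMean1 (φ : 𝓢(EuclideanSpace ℝ (Fin m), ℝ)) :
    IsRadialTest (sphericalMean1 φ) := by
  rw [sphericalMean1_eq_sphMean]
  exact isRadialTest_sphMean (by fun_prop) φ

theorem sphericalMean0_neg (φ : 𝓢(EuclideanSpace ℝ (Fin m), ℝ)) (r : ℝ) :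
    sphericalMean0 φ (-r) = sphericalMean0 φ r := by
  rw [sphericalMean0_eq_sphMean]
  exact sphMean_neg (fun _ => (1 / sphereArea m) • (1 : Cl m)) φ r

theorem sphericalMean1_neg (φ : 𝓢(EuclideanSpace ℝ (Fin m), ℝ)) (r : ℝ) :
    sphericalMean1 φ (-r) = -sphericalMean1 φ r := by
  rw [sphericalMean1_eq_sphMean]
  refine (sphMean_neg (fun x => (1 / sphereArea m) • vec m x) φ r).trans ?_
  simp [sphMean, integral_neg]

theorem sphericalMean0_eq (φ : 𝓢(EuclideanSpace ℝ (Fin m), ℝ)) (r : ℝ) :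
    sphericalMean0 φ r = (1 / sphereArea m) • (sphMean (fun _ => (1 : ℝ)) φ r • (1 : Cl m)) := by
  rw [sphericalMean0, sphMean, ← integral_smul_const]
  simp

theorem sphericalMean1_eq (φ : 𝓢(EuclideanSpace ℝ (Fin m), ℝ)) (r : ℝ) :
    sphericalMean1 φ r = (1 / sphereArea m) •
      ∑ i : Fin m, sphMean (fun u => u.1 i) φ r • (e i.succ : Cl m) := by
  rw [← sphMean_sum_smul _ (fun i => by fun_prop), sphericalMean1, sphMean]
  simp_rw [vec_apply]

/-- Adding the sum to its transpose leaves only anticommutators `e_j e_i + e_i e_j = -2 δ_{ij}`. -/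
theorem sum_symm_mul_e (t : Fin m → Fin m → ℝ) (ht : ∀ i j, t i j = t j i) :
    ∑ j, ∑ i, t i j • ((e j.succ : Cl m) * e i.succ) = -((∑ i, t i i) • (1 : Cl m)) := by
  have h2 : (2 : ℝ) • ∑ j, ∑ i, t i j • ((e j.succ : Cl m) * e i.succ)
      = (2 : ℝ) • -((∑ i, t i i) • (1 : Cl m)) := by
    rw [two_smul]
    conv_lhs => enter [2]; rw [Finset.sum_comm]
    rw [← Finset.sum_add_distrib, smul_neg, Finset.sum_smul, Finset.smul_sum,
      ← Finset.sum_neg_distrib]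
    refine Finset.sum_congr rfl fun j _ => ?_
    rw [← Finset.sum_add_distrib, Finset.sum_eq_single j]
    · rw [e_sq, ← two_smul ℝ, smul_neg, smul_neg]
    · intro i _ hij
      rw [ht j i, ← smul_add, e_anticomm fun h => hij (Fin.succ_injective _ h).symm]
      simp
    · simp
  exact smul_right_injective _ two_ne_zero h2

/-- The radial derivative of `Σ^{(0)}[φ]` in terms of `Σ^{(1)}`. -/
theorem smul_sum_e_mul_sphericalMean1 (φ : 𝓢(EuclideanSpace ℝ (Fin m), ℝ)) (r : ℝ) :
    r • ∑ j : Fin m, -(e j.succ : Cl m) *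
        sphericalMean1 (∂_{EuclideanSpace.single j (1 : ℝ)} φ) r
      = r • deriv (sphericalMean0 φ) r + (0 : ℝ) • sphericalMean0 φ r := by
  have hd : HasDerivAt (sphericalMean0 φ) ((1 / sphereArea m) • ((∑ j : Fin m,
      sphMean (fun u => u.1 j) (∂_{EuclideanSpace.single j (1 : ℝ)} φ) r) • (1 : Cl m))) r := by
    rw [funext (sphericalMean0_eq φ)]
    have h := ((hasDerivAt_sphMean (f := fun _ => (1 : ℝ)) continuous_const φ r).smul_const
      (1 : Cl m)).const_smul (1 / sphereArea m)
    simp only [smul_eq_mul, mul_one] at h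
    exact h
  -- The array `r ∫ u_i ∂_j φ(r u)` is symmetric by rotation invariance, so its Clifford contraction
  -- is minus its trace, which is the radial derivative.
  have h := sum_symm_mul_e (m := m) (fun i j => r * sphMean (fun u => u.1 i)
    (∂_{EuclideanSpace.single j (1 : ℝ)} φ) r) (fun i j => sphMean_rotation φ r i j)
  rw [hd.deriv, zero_smul, add_zero, smul_comm r, smul_smul r, Finset.mul_sum, ← neg_neg
    ((∑ i : Fin m, r * _) • (1 : Cl m)), ← h]
  simp_rw [sphericalMean1_eq, mul_smul_comm, ← Finset.smul_sum, neg_mul, Finset.sum_neg_distrib,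
    Finset.mul_sum, mul_smul_comm, smul_neg, smul_comm r (1 / sphereArea m), Finset.smul_sum,
    smul_smul]

/-- The radial derivative of `Σ^{(1)}[φ]` in terms of `Σ^{(0)}`. -/
theorem smul_sum_e_mul_sphericalMean0 (φ : 𝓢(EuclideanSpace ℝ (Fin m), ℝ)) (r : ℝ) :
    r • ∑ j : Fin m, (e j.succ : Cl m) *
        sphericalMean0 (∂_{EuclideanSpace.single j (1 : ℝ)} φ) r
      = r • deriv (sphericalMean1 φ) r + ((m : ℝ) - 1) • sphericalMean1 φ r := by
  have hd : HasDerivAt (sphericalMean1 φ) ((1 / sphereArea m) • ∑ i : Fin m, (∑ j : Fin m,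
      sphMean (fun u => u.1 j * u.1 i) (∂_{EuclideanSpace.single j (1 : ℝ)} φ) r) •
        (e i.succ : Cl m)) r := by
    rw [funext (sphericalMean1_eq φ)]
    refine HasDerivAt.const_smul (1 / sphereArea m) (HasDerivAt.fun_sum fun i _ => ?_)
    have h := (hasDerivAt_sphMean (f := fun u => u.1 i) (by fun_prop) φ r).smul_const
      (e i.succ : Cl m)
    simp only [smul_eq_mul] at h
    exact h
  rw [hd.deriv, sphericalMean1_eq, smul_comm r (1 / sphereArea m),
    smul_comm ((m : ℝ) - 1) (1 / sphereArea m), ← smul_add, Finset.smul_sum, Finset.smul_sum,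
    Finset.smul_sum, ← Finset.sum_add_distrib, Finset.smul_sum]
  refine Finset.sum_congr rfl fun i _ => ?_
  rw [smul_smul r, smul_smul ((m : ℝ) - 1), ← add_smul, ← sphMean_partial, sphericalMean0_eq,
    mul_smul_comm, mul_smul_comm, mul_one, smul_comm r, smul_smul r]

end Means

variable {m : ℕ}

/-! ### The Dirac operator and finite parts -/

theorem FinitePartExists.tendsto {F : Type*} [NormedAddCommGroup F] [NormedSpace ℝ F] {μ : ℤ}
    {ψ : ℝ → F} (h : FinitePartExists μ ψ) :
    Tendsto (hadamardReg μ ψ) (𝓝[>] 0) (𝓝 (finitePart μ ψ)) :=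
  tendsto_nhds_limUnder h

/-- If `r s ∑_j e_j M[∂_j φ] = r N[φ]' + c N[φ]`, then the Dirac operator maps the finite part
distribution of order `-n` attached to `M` to that of order `-n-1` attached to `N`. -/
theorem dirac_finitePart {M N : 𝓢(EuclideanSpace ℝ (Fin m), ℝ) → ℝ → Cl m}
    (hM : ∀ φ, IsRadialTest (M φ)) (hN : ∀ φ, IsRadialTest (N φ)) {c s : ℝ} (hs : s * s = 1)
    (hMN : ∀ φ (r : ℝ), r • ∑ j : Fin m, (s • (e j.succ : Cl m)) *
        M (∂_{EuclideanSpace.single j (1 : ℝ)} φ) r = r • deriv (N φ) r + c • N φ r)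
    {n : ℕ} (hn : n ≠ 0) (h0 : ∀ φ, iteratedDeriv n (N φ) 0 = 0) (hc : c + n ≠ 0)
    {T : CliffordDistrib m} {a : ℝ}
    (hT : ∀ φ, FinitePartExists (-(n : ℤ)) (M φ) ∧ T φ = a • finitePart (-(n : ℤ)) (M φ))
    (φ : 𝓢(EuclideanSpace ℝ (Fin m), ℝ)) :
    FinitePartExists (-((n + 1 : ℕ) : ℤ)) (N φ) ∧
      dirac T φ = (-(s * a * (c + n))) • finitePart (-((n + 1 : ℕ) : ℤ)) (N φ) := by
  set G : ℝ → Cl m := fun r => ∑ j : Fin m, mulLeftCLM (s • (e j.succ : Cl m))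
    (M (∂_{EuclideanSpace.single j (1 : ℝ)} φ) r) with hG
  set l : Cl m := ∑ j : Fin m, mulLeftCLM (s • (e j.succ : Cl m))
    (finitePart (-(n : ℤ)) (M (∂_{EuclideanSpace.single j (1 : ℝ)} φ))) with hl
  have hlim : Tendsto (hadamardReg (-(n : ℤ)) G) (𝓝[>] 0) (𝓝 l) := by
    have h := tendsto_finsetSum Finset.univ fun (j : Fin m) _ =>
      ((mulLeftCLM (s • (e j.succ : Cl m))).continuous.tendsto _).comp
        (hT (∂_{EuclideanSpace.single j (1 : ℝ)} φ)).1.tendsto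
    refine h.congr' ?_
    filter_upwards [self_mem_nhdsWithin] with ε hε
    exact (hadamardReg_sum_clm Finset.univ (fun j : Fin m => mulLeftCLM (s • (e j.succ : Cl m)))
      (fun j _ => hM (∂_{EuclideanSpace.single j (1 : ℝ)} φ)) n hε).symm
  have hGs : ContDiff ℝ ∞ G := ContDiff.sum fun j _ =>
    (mulLeftCLM (s • (e j.succ : Cl m))).contDiff.comp (hM _).contDiff
  have hlimN := tendsto_hadamardReg_succ (hN φ) hGs (hMN φ) hn (h0 φ) hc hlim
  refine ⟨⟨_, hlimN⟩, ?_⟩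
  have hfp : finitePart (-((n + 1 : ℕ) : ℤ)) (N φ) = (c + n)⁻¹ • l := hlimN.limUnder_eq
  have hl' : l = s • ∑ j : Fin m, e j.succ *
      finitePart (-(n : ℤ)) (M (∂_{EuclideanSpace.single j (1 : ℝ)} φ)) := by
    rw [hl, Finset.smul_sum]
    exact Finset.sum_congr rfl fun j _ => by rw [mulLeftCLM_apply, smul_mul_assoc]
  rw [dirac_apply, hfp, hl', smul_smul, smul_smul]
  -- The sign `s` occurs once in the radial relation and once in the constant, and `s² = 1`.
  have : -(s * a * (c + n)) * (c + n)⁻¹ * s = -a := by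
    have : s * a * (c + n) * (c + n)⁻¹ * s = (s * s) * a * ((c + n) * (c + n)⁻¹) := by ring
    rw [neg_mul, neg_mul, this, hs, mul_inv_cancel₀ hc, one_mul, mul_one]
  rw [this, neg_smul, Finset.smul_sum]
  congr 1
  exact Finset.sum_congr rfl fun j _ => by rw [(hT _).2, mul_smul_comm]

/-- The radial relation has `c = 0`, so the factor is `n`. Odd `n` annihilates the correction at the
origin, as `Σ^{(0)}` is even. -/
theorem EqFpU.dirac {T : CliffordDistrib m} {c : ℝ} {lam : ℤ} (hT : EqFpU T c lam) {n : ℕ}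
    (hn : Odd n) (hlam : lam + m - 1 = -(n : ℤ)) :
    EqFpT (dirac T) (c * n) (lam - 1) := by
  intro φ
  have hn0 : n ≠ 0 := hn.pos.ne'
  have hlam' : lam - 1 + m - 1 = -((n + 1 : ℕ) : ℤ) := by push_cast; linarith
  have h := dirac_finitePart (M := sphericalMean1) (N := sphericalMean0) (s := -1) (c := 0)
    isRadialTest_sphericalMean1 isRadialTest_sphericalMean0 (by norm_num)
    (fun φ r => by simpa only [neg_one_smul] using smul_sum_e_mul_sphericalMean1 φ r) hn0
    (fun φ => iteratedDeriv_zero_of_even (sphericalMean0_neg φ) hn)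
    (by rw [zero_add]; exact Nat.cast_ne_zero.2 hn0) (T := T) (a := c * sphereArea m)
    (fun φ => by rw [← hlam]; exact ⟨(hT φ).1, by rw [(hT φ).2, fpU, smul_smul]⟩) φ
  rw [fpT, hlam', smul_smul]
  refine ⟨h.1, h.2.trans ?_⟩
  congr 1
  ring

/-- The radial relation has `c = m - 1`, so the factor is `m - 1 + n`. Even `n` annihilates the
correction, as `Σ^{(1)}` is odd. -/
theorem EqFpT.dirac (hm : 1 ≤ m) {T : CliffordDistrib m} {c : ℝ} {lam : ℤ} (hT : EqFpT T c lam)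
    {n : ℕ} (hn : Even n) (hn0 : n ≠ 0) (hlam : lam + m - 1 = -(n : ℤ)) :
    EqFpU (Downstream.dirac T) (-(c * ((m : ℝ) - 1 + n))) (lam - 1) := by
  intro φ
  have hlam' : lam - 1 + m - 1 = -((n + 1 : ℕ) : ℤ) := by push_cast; linarith
  have hm' : (1 : ℝ) ≤ m := by exact_mod_cast hm
  have hn' : (0 : ℝ) < n := by exact_mod_cast Nat.pos_of_ne_zero hn0
  have h := dirac_finitePart (M := sphericalMean0) (N := sphericalMean1) (s := 1)
    (c := (m : ℝ) - 1) isRadialTest_sphericalMean0 isRadialTest_sphericalMean1 (by norm_num)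
    (fun φ r => by simpa only [one_smul] using smul_sum_e_mul_sphericalMean0 φ r) hn0
    (fun φ => iteratedDeriv_zero_of_odd (sphericalMean1_neg φ) hn)
    (by linarith) (T := T) (a := c * sphereArea m)
    (fun φ => by rw [← hlam]; exact ⟨(hT φ).1, by rw [(hT φ).2, fpT, smul_smul]⟩) φ
  rw [fpU, hlam', smul_smul]
  refine ⟨h.1, h.2.trans ?_⟩
  congr 1
  ring

theorem EqFpT.neg {T : CliffordDistrib m} {c : ℝ} {lam : ℤ} (hT : EqFpT T c lam) :
    EqFpT (-T) (-c) lam := fun φ =>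
  ⟨(hT φ).1, by rw [neg_smul, ← (hT φ).2]; rfl⟩

/-! ### The Hilbert kernel as a finite part -/

theorem integrableOn_truncatedPv (φ : 𝓢(EuclideanSpace ℝ (Fin m), ℝ)) {ε : ℝ} (hε : 0 < ε) :
    IntegrableOn (fun x => (φ x / ‖x‖ ^ m) • (‖x‖⁻¹ • x)) {x | ε < ‖x‖} := by
  have hSm : MeasurableSet {x : EuclideanSpace ℝ (Fin m) | ε < ‖x‖} :=
    measurableSet_lt measurable_const measurable_norm
  refine ((φ.integrable.norm.mul_const (ε ^ m)⁻¹).integrableOn).mono' ?_ ?_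
  · have := φ.continuous.measurable
    exact Measurable.aestronglyMeasurable (by fun_prop)
  · refine (ae_restrict_iff' hSm).2 (Eventually.of_forall fun x hx => ?_)
    have hx' : ε < ‖x‖ := hx
    have h1 : ‖x‖⁻¹ * ‖x‖ ≤ 1 := inv_mul_le_one
    rw [norm_smul, norm_smul, norm_inv, norm_norm, norm_div, norm_pow, norm_norm, div_eq_mul_inv]
    refine (mul_le_of_le_one_right (by positivity) h1).trans ?_
    gcongr

/-- At order `-1` the only counterterm is `log ε` times `Σ^{(1)}[φ](0)`, which is zero by oddness.
Principal value and finite part therefore agree before the limit. -/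
theorem vec_truncatedPv (hm : 1 ≤ m) (φ : 𝓢(EuclideanSpace ℝ (Fin m), ℝ)) {ε : ℝ} (hε : 0 < ε) :
    vec m (truncatedPv φ ε) = sphereArea m • hadamardReg (-1) (sphericalMean1 φ) ε := by
  have hσ := (sphereArea_pos (Nat.pos_of_ne_zero (Nat.one_le_iff_ne_zero.1 hm))).ne'
  have h0 : sphericalMean1 φ 0 = 0 := by
    have := sphericalMean1_neg φ 0
    rw [neg_zero] at this
    exact eq_zero_of_eq_neg_self this
  have hreg : hadamardReg (-1) (sphericalMean1 φ) ε
      = ∫ r in Ioi ε, r ^ (-1 : ℤ) • sphericalMean1 φ r := by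
    simp [hadamardReg, h0]
  have hint := integrableOn_truncatedPv φ hε
  rw [hreg, truncatedPv, ← (vec m).integral_comp_comm hint,
    setIntegral_norm_gt_eq (Nat.one_le_iff_ne_zero.1 hm) hε.le ((vec m).integrable_comp hint),
    ← integral_smul]
  refine setIntegral_congr_fun measurableSet_Ioi fun r hr => ?_
  have hr0 : 0 < r := hε.trans hr
  have hpt : ∀ u : Metric.sphere (0 : EuclideanSpace ℝ (Fin m)) 1,
      vec m ((φ (r • u.1) / ‖r • u.1‖ ^ m) • (‖r • u.1‖⁻¹ • r • u.1))
        = (r ^ m)⁻¹ • φ (r • u.1) • vec m u.1 := by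
    intro u
    have hn : ‖r • u.1‖ = r := by simp [norm_smul, abs_of_pos hr0]
    rw [hn, smul_smul r⁻¹, inv_mul_cancel₀ hr0.ne', one_smul, map_smul, div_eq_inv_mul, mul_smul]
  simp_rw [hpt]
  rw [integral_smul, sphericalMean1, smul_comm (r ^ (-1 : ℤ)), smul_smul (sphereArea m),
    mul_one_div_cancel hσ, one_smul, smul_smul]
  congr 1
  obtain ⟨k, rfl⟩ : ∃ k, m = k + 1 := ⟨m - 1, by omega⟩
  rw [zpow_neg_one, Nat.add_sub_cancel, pow_succ]
  field_simp

theorem eqFpU_hilbertKernel (hm : 1 ≤ m) :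
    EqFpU (hilbertKernel m) (-(2 / sphereArea (m + 1))) (-(m : ℤ)) := by
  intro φ
  have hσ := (sphereArea_pos (Nat.pos_of_ne_zero (Nat.one_le_iff_ne_zero.1 hm))).ne'
  have hlim : Tendsto (hadamardReg (-1) (sphericalMean1 φ)) (𝓝[>] 0)
      (𝓝 ((sphereArea m)⁻¹ • vec m (pv φ))) := by
    refine ((((vec m).continuous.tendsto _).comp (tendsto_truncatedPv φ)).const_smul
      (sphereArea m)⁻¹).congr' ?_
    filter_upwards [self_mem_nhdsWithin] with ε hε
    rw [Function.comp_apply, vec_truncatedPv hm φ hε, smul_smul, inv_mul_cancel₀ hσ, one_smul]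
  have hlam : -(m : ℤ) + m - 1 = -1 := by ring
  rw [fpU, hlam]
  refine ⟨⟨_, hlim⟩, ?_⟩
  have : finitePart (-1) (sphericalMean1 φ) = (sphereArea m)⁻¹ • vec m (pv φ) := hlim.limUnder_eq
  rw [this, smul_smul (sphereArea m), mul_inv_cancel₀ hσ, one_smul]
  rfl

/-! ### Iterated derivatives of the Hilbert kernel -/

/-- Start from `H` with `n = 1` and constant `-2/σ_{m+1}`. The step from `\underline{∂}^{2l}` has `n
= 2l + 1` and factor `2l + 1`; the next has `n = 2l + 2` and factor `-(m + 1 + 2l)`. -/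
theorem eqFp_dirac_iterate_hilbertKernel (hm : 1 ≤ m) (l : ℕ) :
    EqFpU (dirac^[2 * l] (hilbertKernel m))
      ((-1) ^ (l + 1) * (Nat.doubleFactorial (2 * l - 1) : ℝ) *
        (∏ i ∈ Finset.range l, ((m : ℝ) + 1 + 2 * i)) * (2 / sphereArea (m + 1)))
      (-((m : ℤ) + 2 * l)) ∧
    EqFpT (dirac^[2 * l + 1] (hilbertKernel m))
      ((-1) ^ (l + 1) * (Nat.doubleFactorial (2 * l + 1) : ℝ) *
        (∏ i ∈ Finset.range l, ((m : ℝ) + 1 + 2 * i)) * (2 / sphereArea (m + 1)))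
      (-((m : ℤ) + 2 * l + 1)) := by
  have odd : ∀ l : ℕ, EqFpU (dirac^[2 * l] (hilbertKernel m))
      ((-1) ^ (l + 1) * (Nat.doubleFactorial (2 * l - 1) : ℝ) *
        (∏ i ∈ Finset.range l, ((m : ℝ) + 1 + 2 * i)) * (2 / sphereArea (m + 1)))
      (-((m : ℤ) + 2 * l)) → EqFpT (dirac^[2 * l + 1] (hilbertKernel m))
      ((-1) ^ (l + 1) * (Nat.doubleFactorial (2 * l + 1) : ℝ) *
        (∏ i ∈ Finset.range l, ((m : ℝ) + 1 + 2 * i)) * (2 / sphereArea (m + 1)))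
      (-((m : ℤ) + 2 * l + 1)) := fun l h => by
    have h' := h.dirac (n := 2 * l + 1) ⟨l, rfl⟩ (by push_cast; ring)
    rw [← Function.iterate_succ_apply' dirac] at h'
    convert h' using 1
    · have : (Nat.doubleFactorial (2 * l + 1) : ℝ)
          = Nat.doubleFactorial (2 * l - 1) * ((2 * l + 1 : ℕ) : ℝ) := by
        -- For `l = 0` the index `2 * l - 1` truncates to `0`, and `0‼ = 1` is the conventional
        -- value of `(-1)‼`.
        rcases l with _ | l
        · simp
        · rw [show 2 * (l + 1) + 1 = (2 * l + 1) + 2 by ring, Nat.doubleFactorial_add_two,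
            show 2 * (l + 1) - 1 = 2 * l + 1 by omega]
          push_cast
          ring
      rw [this]
      ring
    · ring
  have even : ∀ l : ℕ, EqFpU (dirac^[2 * l] (hilbertKernel m))
      ((-1) ^ (l + 1) * (Nat.doubleFactorial (2 * l - 1) : ℝ) *
        (∏ i ∈ Finset.range l, ((m : ℝ) + 1 + 2 * i)) * (2 / sphereArea (m + 1)))
      (-((m : ℤ) + 2 * l)) := fun l => by
    induction l with
    | zero => simpa using eqFpU_hilbertKernel hm
    | succ l ih =>
      have h' := (odd l ih).dirac hm (n := 2 * l + 2) ⟨l + 1, by ring⟩ (by omega)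
        (by push_cast; ring)
      rw [← Function.iterate_succ_apply' dirac] at h'
      convert h' using 1
      · rfl
      · rw [Finset.prod_range_succ, show 2 * (l + 1) - 1 = 2 * l + 1 by omega]
        push_cast
        ring
      · push_cast
        ring
  exact ⟨even l, odd l (even l)⟩

/-! ### The constants: products and Gamma values -/

theorem two_div_sphereArea (m : ℕ) : 2 / sphereArea (m + 1)
    = Real.Gamma (((m : ℝ) + 1) / 2) / Real.pi ^ (((m : ℝ) + 1) / 2) := by
  have h1 := Real.Gamma_pos_of_pos (by positivity : (0 : ℝ) < ((m : ℝ) + 1) / 2)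
  have h2 := Real.rpow_pos_of_pos Real.pi_pos (((m : ℝ) + 1) / 2)
  rw [sphereArea]
  push_cast
  field_simp

/-- The two forms of the constants agree. -/
theorem two_pow_mul_Gamma_div (m k : ℕ) :
    2 ^ k * (Real.Gamma (((m : ℝ) + 1) / 2 + k) / Real.pi ^ (((m : ℝ) + 1) / 2))
      = (∏ i ∈ Finset.range k, ((m : ℝ) + 1 + 2 * i)) * (2 / sphereArea (m + 1)) := by
  rw [two_div_sphereArea]
  induction k with
  | zero => simp
  | succ k ih =>
    have hpos : ((m : ℝ) + 1) / 2 + k ≠ 0 := by positivity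
    rw [Finset.prod_range_succ, mul_right_comm, ← ih]
    push_cast
    rw [← add_assoc, Real.Gamma_add_one hpos]
    ring

end Downstream

end

/-! ### Boundary values and explicit forms of the downstream potentials -/

theorem mainTheorem8 (m : ℕ) (hm : 1 ≤ m) (l : ℕ) (hl : 1 ≤ l) :
    -- `a_{-2l}^- = a_{-2l}^+ = -∂^{2l-1} H`
    (Downstream.IsBoundaryValue (𝓝[<] 0) (Downstream.potA m (2 * l - 1))
        (-(Downstream.dirac^[2 * l - 1] (Downstream.hilbertKernel m))) ∧
      Downstream.IsBoundaryValue (𝓝[>] 0) (Downstream.potA m (2 * l - 1))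
        (-(Downstream.dirac^[2 * l - 1] (Downstream.hilbertKernel m)))) ∧
    -- `a_{-2l-1}^- = -a_{-2l-1}^+ = -∂^{2l} δ`
    (Downstream.IsBoundaryValue (𝓝[<] 0) (Downstream.potA m (2 * l))
        (-(Downstream.dirac^[2 * l] (Downstream.delta m))) ∧
      Downstream.IsBoundaryValue (𝓝[>] 0) (Downstream.potA m (2 * l))
        (Downstream.dirac^[2 * l] (Downstream.delta m))) ∧
    -- `b_{-2l}^- = -b_{-2l}^+ = ∂^{2l-1} δ`
    (Downstream.IsBoundaryValue (𝓝[<] 0) (Downstream.potB m (2 * l - 1))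
        (Downstream.dirac^[2 * l - 1] (Downstream.delta m)) ∧
      Downstream.IsBoundaryValue (𝓝[>] 0) (Downstream.potB m (2 * l - 1))
        (-(Downstream.dirac^[2 * l - 1] (Downstream.delta m)))) ∧
    -- `b_{-2l-1}^- = b_{-2l-1}^+ = ∂^{2l} H`
    (Downstream.IsBoundaryValue (𝓝[<] 0) (Downstream.potB m (2 * l))
        (Downstream.dirac^[2 * l] (Downstream.hilbertKernel m)) ∧
      Downstream.IsBoundaryValue (𝓝[>] 0) (Downstream.potB m (2 * l))
        (Downstream.dirac^[2 * l] (Downstream.hilbertKernel m))) ∧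
    -- the two explicit forms of `a_{-2l}^± = -∂^{2l-1} H` as a multiple of `Fp 1/r^{m+2l-1}`
    (Downstream.EqFpT (-(Downstream.dirac^[2 * l - 1] (Downstream.hilbertKernel m)))
        ((-1) ^ (l - 1) * 2 ^ (l - 1) * (Nat.doubleFactorial (2 * l - 1) : ℝ) *
          (Real.Gamma (((m : ℝ) + 2 * l - 1) / 2) / Real.pi ^ (((m : ℝ) + 1) / 2)))
        (-((m : ℤ) + 2 * l - 1)) ∧
      Downstream.EqFpT (-(Downstream.dirac^[2 * l - 1] (Downstream.hilbertKernel m)))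
        ((-1) ^ (l - 1) * (Nat.doubleFactorial (2 * l - 1) : ℝ) *
          (∏ i ∈ Finset.range (l - 1), ((m : ℝ) + 1 + 2 * i)) *
          (2 / Downstream.sphereArea (m + 1)))
        (-((m : ℤ) + 2 * l - 1))) ∧
    -- the two explicit forms of `b_{-2l-1}^± = ∂^{2l} H` as a multiple of `Fp ω/r^{m+2l}`
    (Downstream.EqFpU (Downstream.dirac^[2 * l] (Downstream.hilbertKernel m))
        ((-1) ^ (l - 1) * 2 ^ l * (Nat.doubleFactorial (2 * l - 1) : ℝ) *
          (Real.Gamma (((m : ℝ) + 2 * l + 1) / 2) / Real.pi ^ (((m : ℝ) + 1) / 2)))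
        (-((m : ℤ) + 2 * l)) ∧
      Downstream.EqFpU (Downstream.dirac^[2 * l] (Downstream.hilbertKernel m))
        ((-1) ^ (l - 1) * (Nat.doubleFactorial (2 * l - 1) : ℝ) *
          (∏ i ∈ Finset.range l, ((m : ℝ) + 1 + 2 * i)) *
          (2 / Downstream.sphereArea (m + 1)))
        (-((m : ℤ) + 2 * l))) := by
  obtain ⟨k, rfl⟩ : ∃ k, l = k + 1 := ⟨l - 1, by omega⟩
  have hpos : ∀ᶠ x₀ : ℝ in 𝓝[>] 0, x₀ ≠ 0 := by
    filter_upwards [self_mem_nhdsWithin] with t ht using (ne_of_gt ht)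
  have hneg : ∀ᶠ x₀ : ℝ in 𝓝[<] 0, x₀ ≠ 0 := by
    filter_upwards [self_mem_nhdsWithin] with t ht using (ne_of_lt ht)
  have hodd : 2 * (k + 1) - 1 = 2 * k + 1 := by omega
  obtain ⟨hA1, hA2⟩ := Downstream.isBoundaryValue_potA_zero m
  have hB1 := Downstream.isBoundaryValue_potB_zero (m := m) (l := 𝓝[>] 0)
    (nhdsWithin_mono _ fun t ht => ne_of_gt ht)
  have hB2 := Downstream.isBoundaryValue_potB_zero (m := m) (l := 𝓝[<] 0)
    (nhdsWithin_mono _ fun t ht => ne_of_lt ht)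
  have hit : ∀ n : ℕ, Downstream.dirac^[n] (-Downstream.delta m)
      = -(Downstream.dirac^[n] (Downstream.delta m)) := fun n => by
    induction n with
    | zero => rfl
    | succ n ih =>
      rw [Function.iterate_succ_apply', Function.iterate_succ_apply', ih, Downstream.dirac_neg]
  have hP := Downstream.isBoundaryValue_pot hpos hA1 hB1
  have hN := Downstream.isBoundaryValue_pot hneg hA2 hB2
  -- In the lower half-space the iteration starts from `-δ`, which flips exactly the formulas
  -- containing `δ`.
  simp only [hit, neg_neg] at hN
  have hU := (Downstream.eqFp_dirac_iterate_hilbertKernel hm (k + 1)).1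
  -- With `l = k + 1`, the odd power `2l - 1 = 2k + 1` comes from index `k`, which is why its
  -- product has one factor fewer than that of `hU`.
  have hT := (Downstream.eqFp_dirac_iterate_hilbertKernel hm k).2.neg
  have hc := Downstream.two_pow_mul_Gamma_div m
  rw [hodd] at hU ⊢
  rw [Nat.add_sub_cancel]
  refine ⟨⟨(hN k).2.1, (hP k).2.1⟩, ⟨(hN (k + 1)).1.1, (hP (k + 1)).1.1⟩,
    ⟨(hN k).2.2, (hP k).2.2⟩, ⟨(hN (k + 1)).1.2, (hP (k + 1)).1.2⟩, ⟨?_, ?_⟩, ⟨?_, ?_⟩⟩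
  · convert hT using 1
    -- This brings the Gamma argument to `(m+1)/2` plus an integer, so that the functional equation
    -- gives the product.
    · have hG : ((m : ℝ) + 2 * ((k + 1 : ℕ) : ℝ) - 1) / 2 = ((m : ℝ) + 1) / 2 + k := by
        push_cast; ring
      rw [hG, mul_assoc _ _ (2 / Downstream.sphereArea (m + 1)), ← hc k, pow_succ (-1 : ℝ)]
      ring
    · push_cast; ring
  · convert hT using 1
    · rw [pow_succ (-1 : ℝ)]
      ring
    · push_cast; ring
  · convert hU using 1
    · have hG : ((m : ℝ) + 2 * ((k + 1 : ℕ) : ℝ) + 1) / 2 = ((m : ℝ) + 1) / 2 + (k + 1 : ℕ) := by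
        push_cast; ring
      rw [hG, mul_assoc _ _ (2 / Downstream.sphereArea (m + 1)), ← hc (k + 1), pow_succ (-1 : ℝ),
        pow_succ (-1 : ℝ)]
      ring
  · convert hU using 1
    rw [pow_succ (-1 : ℝ), pow_succ (-1 : ℝ)]
    ring
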